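/- Let $k$ be a field and $A$ a finite-dimensional $k$-algebra; write $A\text{-mod}$ for the category of finitely generated left $A$-modules. A module $M\in A\text{-mod}$ is *Gorenstein projective* if $M\cong\ker d^0$ for some exact complex $P^\bullet=(\cdots\to P^{-1}\to P^0\xrightarrow{d^0}P^1\to\cdots)$ of finitely generated projective $A$-modules such that $\mathrm{Hom}_A(P^\bullet,Q)$ is exact for every finitely generated projective $A$-module $Q$. The *Gorenstein projective dimension* $\mathcal{G}p\mathrm{dim}\,M$ is the smallest $n\ge 0$ such that there is an exact sequence $0\to G_n\to\cdots\to G_1\to G_0\to M\to 0$ with all $G_i$ finitely generated Gorenstein projective, and $\infty$ if there is none. The *bounded Gorenstein derived category* $D^b_{gp}(A)$ is the Verdier quotient of the bounded homotopy category $K^b(A\text{-mod})$ by the triangulated subcategory of those complexes $C^\bullet$ for which $\mathrm{Hom}_A(G',C^\bullet)$ is exact for every finitely generated Gorenstein projective module $G'$; modules are viewed in it as complexes concentrated in degree $0$. For an object $M$ of a triangulated category let $\mathrm{add}$ denote the closure under finite direct sums and direct summands, and put $\langle M\rangle_1=\mathrm{add}\{M[i]\mid i\in\mathbb{Z}\}$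 and, for $n\ge 1$, $$\langle M\rangle_{n+1}=\mathrm{add}\{X\mid \text{there is a distinguished triangle } M'\to X\to M''\to M'[1] \text{ with } M'\in\langle M\rangle_1,\ M''\in\langle M\rangle_n\};$$ by convention $\langle M\rangle_0$ consists of the zero objects. Assume that $A$ is of *finite CM-type*, i.e. that there are only finitely many isomorphism classes of finitely generated indecomposable Gorenstein projective $A$-modules. Let $G_1,\dots,G_m$ be all the pairwise non-isomorphic ones and $G=\bigoplus_{i=1}^m G_i$. Let $X\in A\text{-mod}$ be nonzero with $\mathcal{G}p\mathrm{dim}\,X=n<\infty$. Then $X\notin\langle G\rangle_n$ in $D^b_{gp}(A)$. -/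

import Mathlib

open CategoryTheory Limits Pretriangulated ZeroObject

universe u

/-! ### Gorenstein projective modules

Throughout, `FGModuleCat A` is the category `A-mod` of finitely generated left `A`-modules. -/

section Modules

variable {A : Type u} [Ring A]

/-- A totally acyclic complex of finitely generated projective `A`-modules: an exact complex `P`
of such modules for which `Hom_A(P, Q)` is exact for every finitely generated projective `Q`. -/
structure IsTotallyAcyclic (P : CochainComplex (FGModuleCat.{u} A) ℤ) : Prop where
  projective (i : ℤ) : Module.Projective A (P.X i)
  exact (i j l : ℤ) (hij : i + 1 = j) (hjl : j + 1 = l) :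
    Function.Exact (P.d i j).hom.hom (P.d j l).hom.hom
  /-- Exactness of `Hom(P_l, Q) ⟶ Hom(P_j, Q) ⟶ Hom(P_i, Q)`. -/
  hom_exact (Q : FGModuleCat.{u} A) (hQ : Module.Projective A Q) (i j l : ℤ)
    (hij : i + 1 = j) (hjl : j + 1 = l) (f : P.X j ⟶ Q) (hf : P.d i j ≫ f = 0) :
    ∃ g : P.X l ⟶ Q, P.d j l ≫ g = f

/-- A finitely generated module is Gorenstein projective if it is isomorphic to `ker d⁰` for some
totally acyclic complex of finitely generated projective modules. -/
def IsGorensteinProjective (M : FGModuleCat.{u} A) : Prop :=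
  ∃ P : CochainComplex (FGModuleCat.{u} A) ℤ, IsTotallyAcyclic P ∧
    Nonempty (M ≃ₗ[A] LinearMap.ker (P.d 0 1).hom.hom)

/-- There is an exact sequence `0 ⟶ G_n ⟶ ⋯ ⟶ G_1 ⟶ G_0 ⟶ M ⟶ 0` in which all `G_i` are finitely
generated Gorenstein projective. It is written as an infinite sequence with `G_i = 0` for
`i > n`; `d i` is the map `G_{i+1} ⟶ G_i` and `ε` the map `G_0 ⟶ M`. -/
def HasGorensteinProjectiveResolution (M : FGModuleCat.{u} A) (n : ℕ) : Prop :=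
  ∃ (G : ℕ → FGModuleCat.{u} A) (d : ∀ i, G (i + 1) ⟶ G i) (ε : G 0 ⟶ M),
    (∀ i, IsGorensteinProjective (G i)) ∧
    (∀ i, n < i → Subsingleton (G i)) ∧
    Function.Surjective ε.hom.hom ∧
    Function.Exact (d 0).hom.hom ε.hom.hom ∧
    ∀ i, Function.Exact (d (i + 1)).hom.hom (d i).hom.hom

/-- The Gorenstein projective dimension: the least length of a finite resolution by finitely
generated Gorenstein projective modules, and `⊤` if there is none. -/
noncomputable def gorensteinProjectiveDim (M : FGModuleCat.{u} A) : ℕ∞ :=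
  sInf {d : ℕ∞ | ∃ n : ℕ, d = n ∧ HasGorensteinProjectiveResolution M n}

end Modules

instance FGModuleCat.hasZeroObject_of_ring (A : Type u) [Ring A] :
    HasZeroObject (FGModuleCat.{u} A) :=
  hasZeroObject_of_hasInitial_object

instance FGModuleCat.hasFiniteBiproducts_of_ring (A : Type u) [Ring A] :
    HasFiniteBiproducts (FGModuleCat.{u} A) :=
  HasFiniteBiproducts.of_hasFiniteCoproducts

instance FGModuleCat.hasBinaryBiproducts_of_ring (A : Type u) [Ring A] :
    HasBinaryBiproducts (FGModuleCat.{u} A) :=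
  hasBinaryBiproducts_of_finite_biproducts _

section FiniteType

variable (A : Type u) [Ring A]

/-- `A` is of finite CM-type: there are only finitely many isomorphism classes of finitely
generated indecomposable Gorenstein projective `A`-modules. -/
def IsFiniteCMType : Prop :=
  {c : Quotient (isIsomorphicSetoid (FGModuleCat.{u} A)) |
    ∃ M : FGModuleCat.{u} A, Indecomposable M ∧ IsGorensteinProjective M ∧
      Quotient.mk _ M = c}.Finite

variable {A}

/-- `G_1, …, G_m` are all the pairwise non-isomorphic finitely generated indecomposable
Gorenstein projective modules. -/
structure IsIndecGorensteinProjectiveList {m : ℕ} (G : Fin m → FGModuleCat.{u} A) : Prop where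
  indecomposable (i : Fin m) : Indecomposable (G i)
  gorensteinProjective (i : Fin m) : IsGorensteinProjective (G i)
  pairwise_not_iso (i j : Fin m) (h : Nonempty (G i ≅ G j)) : i = j
  complete (M : FGModuleCat.{u} A) (hM : Indecomposable M) (hM' : IsGorensteinProjective M) :
    ∃ i, Nonempty (M ≅ G i)

end FiniteType

/-! ### The bounded homotopy category -/

section Bounded

variable (C : Type*) [Category* C] [Preadditive C]

/-- The objects of the homotopy category whose underlying complex is bounded. -/
def HomotopyCategory.bounded : ObjectProperty (HomotopyCategory C (.up ℤ)) :=
  fun K ↦ ∃ a b : ℤ, ∀ i : ℤ, (i < a ∨ b < i) → IsZero (K.as.X i)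

instance [HasZeroObject C] [HasBinaryBiproducts C] :
    (HomotopyCategory.bounded C).IsTriangulatedClosed₃ where
  ext₃' T hT h₁ h₂ := by
    obtain ⟨a₁, b₁, h₁⟩ := h₁
    obtain ⟨a₂, b₂, h₂⟩ := h₂
    obtain ⟨f : T.obj₁.as ⟶ T.obj₂.as, hf⟩ :=
      (HomotopyCategory.quotient _ _).map_surjective T.mor₁
    refine ⟨_, ?_,
      ⟨Triangle.π₃.mapIso (isoTriangleOfIso₁₂ T _ hT
        (HomotopyCategory.mappingCone_triangleh_distinguished f)
        (Iso.refl _) (Iso.refl _) ?_)⟩⟩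
    · refine ⟨min (a₁ - 1) a₂, max b₁ b₂, fun i hi ↦ ?_⟩
      change IsZero ((CochainComplex.mappingCone f).X i)
      rw [CochainComplex.mappingCone.isZero_X_iff]
      exact ⟨h₁ _ (by omega), h₂ _ (by omega)⟩
    · change T.mor₁ ≫ 𝟙 _ = 𝟙 _ ≫ (HomotopyCategory.quotient _ _).map f
      rw [hf]
      exact (Category.comp_id _).trans (Category.id_comp _).symm

instance : (HomotopyCategory.bounded C).IsStableUnderShift ℤ where
  isStableUnderShiftBy n :=
    { le_shift K hK := by
        obtain ⟨a, b, h⟩ := hK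
        obtain ⟨K : CochainComplex _ _, rfl⟩ := K.quotient_obj_surjective
        rw [ObjectProperty.prop_shift_iff, HomotopyCategory.shift_quotient_obj]
        exact ⟨a - n, b - n, fun i hi ↦ h (i + n) (by omega)⟩ }

instance [HasZeroObject C] [HasBinaryBiproducts C] :
    (HomotopyCategory.bounded C).IsTriangulated where
  exists_zero := ⟨(HomotopyCategory.quotient _ _).obj 0, Functor.map_isZero _ (isZero_zero _),
    0, 0, fun i _ ↦ (HomologicalComplex.eval C (.up ℤ) i).map_isZero (isZero_zero _)⟩
  toIsTriangulatedClosed₂ := .of_isTriangulatedClosed₃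

/-- The bounded homotopy category `K^b(C)`. -/
abbrev HomotopyCategory.Bounded := (HomotopyCategory.bounded C).FullSubcategory

end Bounded

/-! ### The bounded Gorenstein derived category -/

section GorensteinDerived

variable (A : Type u) [Ring A]

/-- The complexes `K` such that `Hom_A(G, K)` is exact for every finitely generated Gorenstein
projective module `G`, as objects of `K(A-mod)`. -/
def gpAcyclic : ObjectProperty (HomotopyCategory (FGModuleCat.{u} A) (.up ℤ)) :=
  fun K ↦ ∀ G : FGModuleCat.{u} A, IsGorensteinProjective G →
    (((preadditiveCoyoneda.obj (Opposite.op G)).mapHomologicalComplex (.up ℤ)).obj K.as).Acyclic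

variable {A} in
lemma gpAcyclic_iff (K : HomotopyCategory (FGModuleCat.{u} A) (.up ℤ)) :
    gpAcyclic A K ↔ ∀ G : FGModuleCat.{u} A, IsGorensteinProjective G →
      (HomotopyCategory.subcategoryAcyclic AddCommGrpCat.{u}).inverseImage
        ((preadditiveCoyoneda.obj (Opposite.op G)).mapHomotopyCategory (.up ℤ)) K :=
  forall₂_congr fun _ _ ↦
    (HomotopyCategory.quotient_obj_mem_subcategoryAcyclic_iff_acyclic _).symm

instance : (gpAcyclic A).IsClosedUnderIsomorphisms where
  of_iso e h := by
    rw [gpAcyclic_iff] at h ⊢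
    exact fun G hG ↦ ObjectProperty.prop_of_iso _ e (h G hG)

instance : (gpAcyclic A).IsTriangulated where
  exists_zero := ⟨0, isZero_zero _, (gpAcyclic_iff _).2 fun _ _ ↦
    ObjectProperty.prop_of_isZero _ (isZero_zero _)⟩
  isStableUnderShiftBy n :=
    { le_shift K hK := (gpAcyclic_iff _).2 fun G hG ↦
        ObjectProperty.le_shift _ n _ ((gpAcyclic_iff K).1 hK G hG) }
  toIsTriangulatedClosed₂ := .mk' fun T hT h₁ h₃ ↦ (gpAcyclic_iff _).2 fun G hG ↦
    ObjectProperty.ext_of_isTriangulatedClosed₂ _ T hT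
      ((gpAcyclic_iff _).1 h₁ G hG) ((gpAcyclic_iff _).1 h₃ G hG)

/-- The triangulated subcategory `K^b_gpac(A-mod)` of `K^b(A-mod)`. -/
abbrev gpAcyclicBounded : ObjectProperty (HomotopyCategory.Bounded (FGModuleCat.{u} A)) :=
  (gpAcyclic A).inverseImage (HomotopyCategory.bounded (FGModuleCat.{u} A)).ι

/-- The bounded Gorenstein derived category `D^b_gp(A)`: the Verdier quotient of `K^b(A-mod)` by
`K^b_gpac(A-mod)`, i.e. its localization at the morphisms whose cone lies in `K^b_gpac(A-mod)`,
with its canonical triangulated structure. -/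
abbrev GorensteinDerivedCategory := (gpAcyclicBounded A).trW.Localization

variable {A}

/-- A module, as an object of `K^b(A-mod)` concentrated in degree `0`. -/
noncomputable def toBoundedHomotopyCategory (X : FGModuleCat.{u} A) :
    HomotopyCategory.Bounded (FGModuleCat.{u} A) where
  obj := (HomotopyCategory.quotient _ _).obj ((CochainComplex.singleFunctor _ 0).obj X)
  property := ⟨0, 0, fun i hi ↦
    HomologicalComplex.isZero_single_obj_X (.up ℤ) 0 X i (by omega)⟩

/-- A module, as an object of `D^b_gp(A)` concentrated in degree `0`. -/
noncomputable def toGorensteinDerivedCategory (X : FGModuleCat.{u} A) :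
    GorensteinDerivedCategory A :=
  (gpAcyclicBounded A).trW.Q.obj (toBoundedHomotopyCategory X)

end GorensteinDerived

/-! ### The filtration generated by an object of a triangulated category -/

section Generation

variable {T : Type*} [Category* T] [HasZeroObject T] [HasShift T ℤ] [Preadditive T]
  [∀ n : ℤ, (shiftFunctor T n).Additive] [Pretriangulated T]

/-- `add P`: the direct summands of finite direct sums of objects satisfying `P`. -/
def addClosure (P : ObjectProperty T) : ObjectProperty T :=
  fun X ↦ ∃ (m : ℕ) (Y : Fin m → T), (∀ i, P (Y i)) ∧ ∃ Z : T, Nonempty (X ⊞ Z ≅ ⨁ Y)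

/-- The subcategories `⟨M⟩_n`. One has `⟨M⟩_1 = add {M[i] | i ∈ ℤ}`, and `⟨M⟩_{n+1}` is `add` of
the objects `X` in a distinguished triangle `M' ⟶ X ⟶ M'' ⟶ M'[1]` with `M' ∈ ⟨M⟩_1` and
`M'' ∈ ⟨M⟩_n`. By the usual convention `⟨M⟩_0` consists of the zero objects. -/
def generatedLevel (M : T) : ℕ → ObjectProperty T
  | 0 => fun X ↦ IsZero X
  | 1 => addClosure fun X ↦ ∃ i : ℤ, Nonempty (X ≅ M⟦i⟧)
  | n + 2 => addClosure
      (ObjectProperty.extensionProduct (generatedLevel M 1) (generatedLevel M (n + 1)))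

end Generation

/-!
The proof is a ghost argument. Right approximations by Gorenstein projective modules exist over an
algebra of finite CM-type (`exists_gorensteinProjective_approximation`), so every module `X` sits in
a short exact sequence `0 ⟶ K ⟶ E ⟶ X ⟶ 0` with `E` Gorenstein projective which stays exact under
`Hom(P, -)` for all Gorenstein projective `P`. Such a sequence gives a distinguished triangle in
`D^b_gp(A)` (`IsProperExact.exists_distinguished`). As Gorenstein projective modules are left
orthogonal to the `gp`-acyclic complexes (`singleBounded_leftOrthogonal`), morphisms out of them in
`D^b_gp(A)` are computed in `K^b(A-mod)`: there are none to a shifted module `Z⟦i⟧` with `i ≠ 0`, and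
for `i = 0` they are the linear maps. Hence the connecting morphism `δ : X ⟶ K⟦1⟧` is a ghost for
`⨁ G`.

Iterating the construction yields a composite of `n` ghosts starting at `X`. By the ghost lemma
(`Annihilates.generatedLevel_comp`) it vanishes if `X ∈ ⟨⨁ G⟩_n`. Peeling off all the connecting
morphisms but the last one, the last one is then zero as well, so the last exact sequence splits, and
the syzygy at its right end, being a direct summand of a Gorenstein projective module, is Gorenstein
projective. Thus `X` has a resolution of length `n - 1`
(`resolution_or_exists_annihilates`). For `n = 0` it suffices that the functor from modules to
`D^b_gp(A)` is faithful.

The closure of Gorenstein projective modules under direct summands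
(`IsGorensteinProjective.of_prod`) is needed for this last step and for the decomposition into
indecomposables behind the approximations. It rests on a coinductive criterion
(`IsGorensteinProjective.of_class`): a class of modules in which each member has a syzygy and
a cosyzygy in the class consists of Gorenstein projective modules.
-/

/-! ### Good sequences -/

section GorensteinProjectives

variable {A : Type u} [Ring A]

/-- A short exact sequence `0 ⟶ M ⟶ P ⟶ N ⟶ 0` with `P` projective such that `Hom_A(-, Q)` keeps it
exact for every finitely generated projective `Q`, i.e. all maps `M ⟶ Q` extend to `P`. Totally
acyclic complexes are the bi-infinite splicings of such sequences. -/
structure IsGoodSequence {M P N : Type u} [AddCommGroup M] [Module A M] [AddCommGroup P]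
    [Module A P] [AddCommGroup N] [Module A N] (i : M →ₗ[A] P) (p : P →ₗ[A] N) : Prop where
  projective : Module.Projective A P
  injective : Function.Injective i
  exact : Function.Exact i p
  surjective : Function.Surjective p
  extend (Q : Type u) [AddCommGroup Q] [Module A Q] [Module.Finite A Q] [Module.Projective A Q]
    (f : M →ₗ[A] Q) : ∃ g : P →ₗ[A] Q, g ∘ₗ i = f

/-- `N` is a cosyzygy of `M` (and `M` a syzygy of `N`): there is a good sequence
`0 ⟶ M ⟶ P ⟶ N ⟶ 0` with `P` finitely generated. -/
def IsCosyzygy (M N : FGModuleCat.{u} A) : Prop :=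
  ∃ (P : FGModuleCat.{u} A) (i : M →ₗ[A] P) (p : P →ₗ[A] N), IsGoodSequence i p

lemma IsGoodSequence.comp_equiv {M M' P N : Type u} [AddCommGroup M] [Module A M]
    [AddCommGroup M'] [Module A M'] [AddCommGroup P] [Module A P] [AddCommGroup N] [Module A N]
    {i : M →ₗ[A] P} {p : P →ₗ[A] N} (h : IsGoodSequence i p) (e : M' ≃ₗ[A] M) :
    IsGoodSequence (i ∘ₗ e.toLinearMap) p where
  projective := h.projective
  injective := h.injective.comp e.injective
  exact y := by
    rw [h.exact y]
    exact ⟨fun ⟨x, hx⟩ ↦ ⟨e.symm x, by simpa using hx⟩, fun ⟨x, hx⟩ ↦ ⟨e x, hx⟩⟩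
  surjective := h.surjective
  extend Q _ _ _ _ f := by
    obtain ⟨g, hg⟩ := h.extend Q (f ∘ₗ e.symm.toLinearMap)
    refine ⟨g, ?_⟩
    rw [← LinearMap.comp_assoc, hg]
    ext x
    simp

lemma IsGoodSequence.equiv_comp {M P N N' : Type u} [AddCommGroup M] [Module A M]
    [AddCommGroup P] [Module A P] [AddCommGroup N] [Module A N] [AddCommGroup N'] [Module A N']
    {i : M →ₗ[A] P} {p : P →ₗ[A] N} (h : IsGoodSequence i p) (e : N ≃ₗ[A] N') :
    IsGoodSequence i (e.toLinearMap ∘ₗ p) where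
  projective := h.projective
  injective := h.injective
  exact y := by simpa using h.exact y
  surjective := e.surjective.comp h.surjective
  extend Q _ _ _ _ f := h.extend Q f

lemma IsGoodSequence.prodMap {M P N M' P' N' : Type u} [AddCommGroup M] [Module A M]
    [AddCommGroup P] [Module A P] [AddCommGroup N] [Module A N]
    [AddCommGroup M'] [Module A M'] [AddCommGroup P'] [Module A P'] [AddCommGroup N']
    [Module A N'] {i : M →ₗ[A] P} {p : P →ₗ[A] N} {i' : M' →ₗ[A] P'} {p' : P' →ₗ[A] N'}
    (h : IsGoodSequence i p) (h' : IsGoodSequence i' p') :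
    IsGoodSequence (i.prodMap i') (p.prodMap p') where
  projective :=
    have := h.projective
    have := h'.projective
    inferInstance
  injective := h.injective.prodMap h'.injective
  exact := fun ⟨x, y⟩ ↦ by
    have h₁ := h.exact x
    have h₂ := h'.exact y
    simp only [LinearMap.prodMap_apply, Prod.mk_eq_zero, Set.mem_range, Prod.exists,
      Prod.mk.injEq] at *
    rw [h₁, h₂]
    exact ⟨fun ⟨⟨a, ha⟩, ⟨b, hb⟩⟩ ↦ ⟨a, b, ha, hb⟩, fun ⟨a, b, ha, hb⟩ ↦ ⟨⟨a, ha⟩, ⟨b, hb⟩⟩⟩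
  surjective := h.surjective.prodMap h'.surjective
  extend Q _ _ _ _ f := by
    obtain ⟨g, hg⟩ := h.extend Q (f ∘ₗ LinearMap.inl A M M')
    obtain ⟨g', hg'⟩ := h'.extend Q (f ∘ₗ LinearMap.inr A M M')
    refine ⟨g.coprod g', ?_⟩
    ext x
    · simpa using LinearMap.congr_fun hg x
    · simpa using LinearMap.congr_fun hg' x

/-! ### Schanuel's lemma -/

/-- Schanuel's lemma for two good sequences with the same left end. -/
lemma IsGoodSequence.cokernel_prod_equiv {M P N P' N' : Type u} [AddCommGroup M] [Module A M]
    [AddCommGroup P] [Module A P] [AddCommGroup N] [Module A N] [AddCommGroup P']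
    [Module A P'] [AddCommGroup N'] [Module A N'] [Module.Finite A P] [Module.Finite A P']
    {i : M →ₗ[A] P} {p : P →ₗ[A] N} {i' : M →ₗ[A] P'} {p' : P' →ₗ[A] N'}
    (h : IsGoodSequence i p) (h' : IsGoodSequence i' p') :
    Nonempty ((N × P') ≃ₗ[A] (P × N')) := by
  have := h.projective
  have := h'.projective
  obtain ⟨g, hg⟩ := h.extend P' i'
  obtain ⟨g', hg'⟩ := h'.extend P i
  let a : P × P' →ₗ[A] N × P' := p.prodMap LinearMap.id
  -- `e` is the automorphism `(x, y) ↦ (x - g' (y + g x), y + g x)`, which moves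
  -- the image of `(i, 0)` to that of `(0, i')`
  let s : P × P' →ₗ[A] P' := LinearMap.snd A P P' + g ∘ₗ LinearMap.fst A P P'
  let b : P × P' →ₗ[A] P × N' := (LinearMap.fst A P P' - g' ∘ₗ s).prod (p' ∘ₗ s)
  have ha : Function.Surjective a := h.surjective.prodMap Function.surjective_id
  have hb : Function.Surjective b := fun ⟨x, z⟩ ↦ by
    obtain ⟨y, rfl⟩ := h'.surjective z
    exact ⟨(x + g' y, y - g (x + g' y)), by simp [b, s]⟩
  have hab : LinearMap.ker a = LinearMap.ker b := by
    ext ⟨x, y⟩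
    have hg (m : M) : g (i m) = i' m := LinearMap.congr_fun hg m
    have hg' (m : M) : g' (i' m) = i m := LinearMap.congr_fun hg' m
    have hax : a (x, y) = (p x, y) := rfl
    have hbx : b (x, y) = (x - g' (y + g x), p' (y + g x)) := rfl
    rw [LinearMap.mem_ker, LinearMap.mem_ker, hax, hbx, Prod.mk_eq_zero, Prod.mk_eq_zero]
    constructor
    · rintro ⟨hx, rfl⟩
      obtain ⟨m, rfl⟩ := (h.exact x).1 hx
      simp [hg, hg', h'.exact.apply_apply_eq_zero]
    · rintro ⟨hx, hy⟩
      obtain ⟨m, hm⟩ := (h'.exact _).1 hy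
      rw [← hm, hg', sub_eq_zero] at hx
      subst hx
      rw [hg] at hm
      exact ⟨h.exact.apply_apply_eq_zero m, by simpa using hm.symm⟩
  exact ⟨(a.quotKerEquivOfSurjective ha).symm ≪≫ₗ Submodule.quotEquivOfEq _ _ hab ≪≫ₗ
    b.quotKerEquivOfSurjective hb⟩

/-- Schanuel's lemma for two projective presentations of the same module. -/
lemma nonempty_ker_prod_equiv {K P M K' P' : Type u} [AddCommGroup M] [Module A M]
    [AddCommGroup P] [Module A P] [AddCommGroup K] [Module A K] [AddCommGroup P']
    [Module A P'] [AddCommGroup K'] [Module A K'] [Module.Projective A P] [Module.Projective A P']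
    {i : K →ₗ[A] P} {q : P →ₗ[A] M} {i' : K' →ₗ[A] P'} {q' : P' →ₗ[A] M}
    (hi : Function.Injective i) (hi' : Function.Injective i')
    (hiq : Function.Exact i q) (hiq' : Function.Exact i' q')
    (hq : Function.Surjective q) (hq' : Function.Surjective q') :
    Nonempty ((K × P') ≃ₗ[A] (P × K')) := by
  obtain ⟨g, hg⟩ := Module.projective_lifting_property q' q hq'
  obtain ⟨g', hg'⟩ := Module.projective_lifting_property q q' hq
  replace hg (x : P) : q' (g x) = q x := LinearMap.congr_fun hg x
  replace hg' (x : P') : q (g' x) = q' x := LinearMap.congr_fun hg' x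
  -- both sides are identified with the kernel of `(x, y) ↦ q x + q' y` on `P × P'`
  let a : K × P' →ₗ[A] P × P' :=
    (i ∘ₗ LinearMap.fst A K P' - g' ∘ₗ LinearMap.snd A K P').prod (LinearMap.snd A K P')
  let b : P × K' →ₗ[A] P × P' :=
    (LinearMap.fst A P K').prod (i' ∘ₗ LinearMap.snd A P K' - g ∘ₗ LinearMap.fst A P K')
  have ha' (x : K) (y : P') : a (x, y) = (i x - g' y, y) := rfl
  have hb' (x : P) (y : K') : b (x, y) = (x, i' y - g x) := rfl
  have ha : Function.Injective a := by
    rw [injective_iff_map_eq_zero]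
    rintro ⟨x, y⟩ h
    rw [ha', Prod.mk_eq_zero] at h
    obtain ⟨h, rfl⟩ := h
    rw [map_zero, sub_zero] at h
    simp [(injective_iff_map_eq_zero i).1 hi x h]
  have hb : Function.Injective b := by
    rw [injective_iff_map_eq_zero]
    rintro ⟨x, y⟩ h
    rw [hb', Prod.mk_eq_zero] at h
    obtain ⟨rfl, h⟩ := h
    rw [map_zero, sub_zero] at h
    simp [(injective_iff_map_eq_zero i').1 hi' y h]
  have hab : LinearMap.range a = LinearMap.range b := by
    ext ⟨x, y⟩
    simp only [LinearMap.mem_range, Prod.exists, ha', hb', Prod.mk.injEq]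
    constructor
    · rintro ⟨k, y, rfl, rfl⟩
      obtain ⟨k', hk'⟩ := (hiq' (y + g (i k - g' y))).1 (by
        simp [hg, hg', hiq.apply_apply_eq_zero])
      exact ⟨_, k', rfl, by simp [hk']⟩
    · rintro ⟨x, k', rfl, rfl⟩
      obtain ⟨k, hk⟩ := (hiq (x + g' (i' k' - g x))).1 (by
        simp [hg, hg', hiq'.apply_apply_eq_zero])
      exact ⟨k, _, by simp [hk], rfl⟩
  exact ⟨LinearEquiv.ofInjective a ha ≪≫ₗ LinearEquiv.ofEq _ _ hab ≪≫ₗ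
    (LinearEquiv.ofInjective b hb).symm⟩

/-- That all maps from the kernel of `P ⟶ M` to projectives extend to `P` does not depend on the
projective presentation: it says that `Ext¹(M, Q) = 0`. -/
lemma IsGoodSequence.of_presentation {K P M K' P' : Type u} [AddCommGroup M] [Module A M]
    [AddCommGroup P] [Module A P] [AddCommGroup K] [Module A K] [AddCommGroup P']
    [Module A P'] [AddCommGroup K'] [Module A K'] [Module.Projective A P']
    {i : K →ₗ[A] P} {q : P →ₗ[A] M} {i' : K' →ₗ[A] P'} {q' : P' →ₗ[A] M}
    (h : IsGoodSequence i q) (hi' : Function.Injective i')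
    (hiq' : Function.Exact i' q') (hq' : Function.Surjective q') :
    IsGoodSequence i' q' where
  projective := inferInstance
  injective := hi'
  exact := hiq'
  surjective := hq'
  extend Q _ _ _ _ f := by
    have := h.projective
    obtain ⟨g, hg⟩ := Module.projective_lifting_property q' q hq'
    obtain ⟨g', hg'⟩ := Module.projective_lifting_property q q' h.surjective
    replace hg (x : P) : q' (g x) = q x := LinearMap.congr_fun hg x
    replace hg' (x : P') : q (g' x) = q' x := LinearMap.congr_fun hg' x
    let e := LinearEquiv.ofInjective i' hi'
    have he (y) : i' (e.symm y) = y := by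
      simp [e]
    -- the restriction of `g` to kernels
    let r : K →ₗ[A] K' := e.symm.toLinearMap ∘ₗ (g ∘ₗ i).codRestrict (LinearMap.range i')
      (fun x ↦ (hiq' _).1 (by simp [hg, h.exact.apply_apply_eq_zero]))
    -- `1 - g g'` lands in the kernel of `q'`
    let t : P' →ₗ[A] K' := e.symm.toLinearMap ∘ₗ
      (LinearMap.id - g ∘ₗ g').codRestrict (LinearMap.range i')
      (fun x ↦ (hiq' _).1 (by simp [hg, hg']))
    have hr (x : K) : i' (r x) = g (i x) := he _
    have ht (x : P') : i' (t x) = x - g (g' x) := he _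
    obtain ⟨w, hw⟩ := h.extend Q (f ∘ₗ r)
    replace hw (x : K) : w (i x) = f (r x) := LinearMap.congr_fun hw x
    refine ⟨w ∘ₗ g' + f ∘ₗ t, ?_⟩
    ext x
    obtain ⟨z, hz⟩ := (h.exact (g' (i' x))).1 (by simp [hg', hiq'.apply_apply_eq_zero])
    have : r z + t (i' x) = x := hi' (by simp [hr, ht, hz])
    simp only [LinearMap.add_apply, LinearMap.comp_apply]
    rw [← hz, hw, ← map_add, this]

/-! ### Gorenstein projective modules: coinduction and closure properties -/

lemma FGModuleCat.congr_hom {M N : FGModuleCat.{u} A} {f g : M ⟶ N} (h : f = g) (x : M) :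
    f.hom.hom x = g.hom.hom x := by
  rw [h]

/-- A relation that is total on both sides admits a bi-infinite chain through any point. -/
lemma exists_int_sequence {S : Type*} (r : S → S → Prop) (hr : ∀ x, ∃ y, r x y)
    (hr' : ∀ x, ∃ y, r y x) (x : S) :
    ∃ f : ℤ → S, f 0 = x ∧ ∀ n, r (f n) (f (n + 1)) := by
  choose next hnext using hr
  choose prev hprev using hr'
  refine ⟨fun n ↦ match n with
    | .ofNat k => next^[k] x
    | .negSucc k => prev^[k + 1] x, rfl, fun n ↦ ?_⟩
  obtain k | _ | k := n
  · change r (next^[k] x) (next^[k + 1] x)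
    rw [Function.iterate_succ_apply']
    exact hnext _
  · exact hprev _
  · change r (prev^[k + 2] x) (prev^[k + 1] x)
    rw [Function.iterate_succ_apply' _ (k + 1)]
    exact hprev _

/-- A class of modules in which cosyzygies and syzygies can be formed indefinitely consists of
Gorenstein projective modules. -/
lemma IsGorensteinProjective.of_class (S : FGModuleCat.{u} A → Prop)
    (hS : ∀ M, S M → ∃ N, S N ∧ IsCosyzygy M N) (hS' : ∀ M, S M → ∃ N, S N ∧ IsCosyzygy N M)
    {M : FGModuleCat.{u} A} (hM : S M) : IsGorensteinProjective M := by
  obtain ⟨f, hf₀, hf⟩ := exists_int_sequence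
    (fun M N : Subtype S ↦ IsCosyzygy M.1 N.1)
    (fun M ↦ (hS M.1 M.2).elim fun N hN ↦ ⟨⟨N, hN.1⟩, hN.2⟩)
    (fun M ↦ (hS' M.1 M.2).elim fun N hN ↦ ⟨⟨N, hN.1⟩, hN.2⟩) ⟨M, hM⟩
  choose P i p h using hf
  let d (n : ℤ) : P n ⟶ P (n + 1) := FGModuleCat.ofHom (i (n + 1) ∘ₗ p n)
  have hd (n : ℤ) : (d n).hom.hom = i (n + 1) ∘ₗ p n := rfl
  let K : CochainComplex (FGModuleCat.{u} A) ℤ := CochainComplex.of P d (fun n ↦ by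
    ext x
    change i _ (p _ (i _ (p _ x))) = 0
    rw [(h (n + 1)).exact.apply_apply_eq_zero, map_zero])
  have hK (n : ℤ) : K.d n (n + 1) = d n := CochainComplex.of_d _ _ _
  refine ⟨K, ⟨fun n ↦ (h n).projective, ?_, ?_⟩, ?_⟩
  · rintro n _ _ rfl rfl
    rw [hK, hK, hd, hd]
    intro y
    constructor
    · intro hy
      have : p (n + 1) y = 0 := (h _).injective (by rw [map_zero]; exact hy)
      obtain ⟨z, rfl⟩ := ((h _).exact y).1 this
      obtain ⟨w, rfl⟩ := (h n).surjective z
      exact ⟨w, rfl⟩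
    · rintro ⟨w, rfl⟩
      change i _ (p _ (i _ (p _ w))) = 0
      rw [(h (n + 1)).exact.apply_apply_eq_zero, map_zero]
  · rintro Q hQ n _ _ rfl rfl φ hφ
    rw [hK] at hφ
    have hφ' (x) : φ.hom.hom (i (n + 1) x) = 0 := by
      obtain ⟨w, rfl⟩ := (h n).surjective x
      exact FGModuleCat.congr_hom hφ w
    let e := (p (n + 1)).quotKerEquivOfSurjective (h (n + 1)).surjective
    have hle : LinearMap.ker (p (n + 1)) ≤ LinearMap.ker φ.hom.hom := fun x hx ↦ by
      obtain ⟨y, rfl⟩ := ((h (n + 1)).exact x).1 hx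
      exact hφ' y
    let ψ : (f (n + 1 + 1)).1 →ₗ[A] Q :=
      (LinearMap.ker (p (n + 1))).liftQ φ.hom.hom hle ∘ₗ e.symm.toLinearMap
    obtain ⟨g, hg⟩ := (h (n + 1 + 1)).extend Q ψ
    refine ⟨FGModuleCat.ofHom g, ?_⟩
    rw [hK]
    ext x
    change g (i _ (p _ x)) = φ.hom.hom x
    have h₁ : g (i _ (p _ x)) = ψ (p _ x) := LinearMap.congr_fun hg _
    have h₂ : e.symm (p (n + 1) x) = Submodule.Quotient.mk x := by
      rw [LinearEquiv.symm_apply_eq]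
      rfl
    rw [h₁]
    change (LinearMap.ker (p (n + 1))).liftQ φ.hom.hom hle (e.symm (p (n + 1) x)) = _
    rw [h₂]
    rfl
  · have h₁ : M = (f 0).1 := by rw [hf₀]
    have h₂ : LinearMap.ker (K.d 0 1).hom.hom = LinearMap.range (i 0) := by
      have : K.d 0 1 = d 0 := hK 0
      rw [this, hd, LinearMap.ker_comp_of_ker_eq_bot _ (LinearMap.ker_eq_bot.2 (h _).injective)]
      exact LinearMap.exact_iff.1 (h 0).exact
    rw [h₂, h₁]
    exact ⟨LinearEquiv.ofInjective _ (h 0).injective⟩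

lemma IsGorensteinProjective.of_equiv {M N : FGModuleCat.{u} A} (hM : IsGorensteinProjective M)
    (e : M ≃ₗ[A] N) : IsGorensteinProjective N := by
  obtain ⟨P, hP, ⟨e'⟩⟩ := hM
  exact ⟨P, hP, ⟨e.symm ≪≫ₗ e'⟩⟩

/-- A totally acyclic complex is cut into good sequences between its consecutive kernels. -/
lemma IsTotallyAcyclic.isGoodSequence {P : CochainComplex (FGModuleCat.{u} A) ℤ}
    (hP : IsTotallyAcyclic P) (i j l : ℤ) (hij : i + 1 = j) (hjl : j + 1 = l) :
    IsGoodSequence (LinearMap.ker (P.d i j).hom.hom).subtype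
      ((P.d i j).hom.hom.codRestrict (LinearMap.ker (P.d j l).hom.hom) fun x ↦
        LinearMap.mem_ker.2 ((hP.exact i j l hij hjl).apply_apply_eq_zero x)) where
  projective := hP.projective i
  injective := Subtype.val_injective
  exact x := by
    rw [Subtype.ext_iff]
    exact ⟨fun hx ↦ ⟨⟨x, hx⟩, rfl⟩, fun ⟨y, hy⟩ ↦ hy ▸ y.2⟩
  surjective := fun ⟨y, hy⟩ ↦ by
    obtain ⟨x, rfl⟩ := (hP.exact i j l hij hjl y).1 hy
    exact ⟨x, rfl⟩
  extend Q _ _ _ hQ f := by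
    have hex := hP.exact (i - 1) i j (by lia) hij
    let c := (P.d (i - 1) i).hom.hom.codRestrict (LinearMap.ker (P.d i j).hom.hom) fun x ↦
      hex.apply_apply_eq_zero x
    obtain ⟨g, hg⟩ := hP.hom_exact (FGModuleCat.of A Q) hQ (i - 2) (i - 1) i (by lia) (by lia)
      (FGModuleCat.ofHom (f ∘ₗ c)) (by
        ext x
        have : c ((P.d (i - 2) (i - 1)).hom.hom x) = 0 := Subtype.ext
          ((hP.exact (i - 2) (i - 1) i (by lia) (by lia)).apply_apply_eq_zero x)
        change f (c ((P.d (i - 2) (i - 1)).hom.hom x)) = 0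
        rw [this, map_zero])
    refine ⟨g.hom.hom, ?_⟩
    ext ⟨x, hx⟩
    obtain ⟨y, rfl⟩ := (hex x).1 hx
    exact FGModuleCat.congr_hom hg y

lemma IsGorensteinProjective.of_projective (M : FGModuleCat.{u} A) [hM : Module.Projective A M] :
    IsGorensteinProjective M := by
  have key (N : FGModuleCat.{u} A) (hN : Module.Projective A N) :
      IsGoodSequence (LinearMap.id : N →ₗ[A] N) (0 : N →ₗ[A] PUnit.{u + 1}) :=
    ⟨hN, Function.injective_id, fun x ↦ by simp, Function.surjective_to_subsingleton _,
      fun Q _ _ _ _ f ↦ ⟨f, rfl⟩⟩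
  have key' (N : FGModuleCat.{u} A) (hN : Module.Projective A N) :
      IsGoodSequence (0 : PUnit.{u + 1} →ₗ[A] N) (LinearMap.id : N →ₗ[A] N) :=
    ⟨hN, Function.injective_of_subsingleton _, fun x ↦ by simp [eq_comm],
      Function.surjective_id, fun Q _ _ _ _ f ↦ ⟨0, Subsingleton.elim _ _⟩⟩
  have h₀ : Module.Projective A PUnit.{u + 1} := inferInstance
  exact of_class (fun N ↦ Module.Projective A N)
    (fun N hN ↦ ⟨FGModuleCat.of A PUnit, h₀, N, _, _, key N hN⟩)
    (fun N hN ↦ ⟨FGModuleCat.of A PUnit, h₀, N, _, _, key' N hN⟩) hM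

/-- Since maps on `C` extend by zero to `C × D`, a good sequence starting at `C × D` restricts to one
starting at `C` with the same middle term. -/
lemma IsGoodSequence.restrict_fst {C D P N : Type u} [AddCommGroup C] [Module A C]
    [AddCommGroup D] [Module A D] [AddCommGroup P] [Module A P] [AddCommGroup N] [Module A N]
    {i : C × D →ₗ[A] P} {p : P →ₗ[A] N} (h : IsGoodSequence i p) :
    IsGoodSequence (i ∘ₗ LinearMap.inl A C D)
      (LinearMap.range (i ∘ₗ LinearMap.inl A C D)).mkQ where
  projective := h.projective
  injective := h.injective.comp LinearMap.inl_injective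
  exact := LinearMap.exact_map_mkQ_range _
  surjective := Submodule.mkQ_surjective _
  extend Q _ _ _ _ f := by
    obtain ⟨g, hg⟩ := h.extend Q (f ∘ₗ LinearMap.fst A C D)
    exact ⟨g, by rw [← LinearMap.comp_assoc, hg]; ext; simp⟩

variable [IsNoetherianRing A]

instance Submodule.finite_of_isNoetherianRing {M : Type*} [AddCommGroup M] [Module A M]
    [Module.Finite A M] (N : Submodule A M) :
    Module.Finite A N :=
  have := isNoetherian_of_isNoetherianRing_of_finite A M
  inferInstance

lemma IsGorensteinProjective.of_ker {P : CochainComplex (FGModuleCat.{u} A) ℤ}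
    (hP : IsTotallyAcyclic P) (i j : ℤ) (hij : i + 1 = j) {M : FGModuleCat.{u} A}
    (e : M ≃ₗ[A] LinearMap.ker (P.d i j).hom.hom) : IsGorensteinProjective M := by
  refine of_class (fun M ↦ ∃ i j, i + 1 = j ∧ Nonempty (M ≃ₗ[A] LinearMap.ker (P.d i j).hom.hom))
    ?_ ?_ ⟨i, j, hij, ⟨e⟩⟩
  · rintro M ⟨i, j, hij, ⟨e⟩⟩
    exact ⟨FGModuleCat.of A (LinearMap.ker (P.d j (j + 1)).hom.hom), ⟨j, j + 1, rfl, ⟨.refl _ _⟩⟩,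
      P.X i, _, _, (hP.isGoodSequence i j (j + 1) hij rfl).comp_equiv e⟩
  · rintro M ⟨j, l, hjl, ⟨e⟩⟩
    exact ⟨FGModuleCat.of A (LinearMap.ker (P.d (j - 1) j).hom.hom),
      ⟨j - 1, j, by lia, ⟨.refl _ _⟩⟩,
      P.X (j - 1), _, _, (hP.isGoodSequence (j - 1) j l (by lia) hjl).equiv_comp e.symm⟩

lemma IsGorensteinProjective.exists_cosyzygy {M : FGModuleCat.{u} A}
    (hM : IsGorensteinProjective M) : ∃ N, IsGorensteinProjective N ∧ IsCosyzygy M N := by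
  obtain ⟨P, hP, ⟨e⟩⟩ := hM
  exact ⟨FGModuleCat.of A (LinearMap.ker (P.d 1 2).hom.hom),
    of_ker hP 1 2 (by lia) (.refl _ _),
    P.X 0, _, _, (hP.isGoodSequence 0 1 2 (by lia) (by lia)).comp_equiv e⟩

lemma IsGorensteinProjective.exists_syzygy {M : FGModuleCat.{u} A}
    (hM : IsGorensteinProjective M) : ∃ N, IsGorensteinProjective N ∧ IsCosyzygy N M := by
  obtain ⟨P, hP, ⟨e⟩⟩ := hM
  exact ⟨FGModuleCat.of A (LinearMap.ker (P.d (-1) 0).hom.hom),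
    of_ker hP (-1) 0 (by lia) (.refl _ _),
    P.X (-1), _, _, (hP.isGoodSequence (-1) 0 1 (by lia) (by lia)).equiv_comp e.symm⟩

lemma IsGorensteinProjective.prod {M N : FGModuleCat.{u} A} (hM : IsGorensteinProjective M)
    (hN : IsGorensteinProjective N) : IsGorensteinProjective (FGModuleCat.of A (M × N)) := by
  refine of_class (fun L ↦ ∃ M N : FGModuleCat.{u} A, IsGorensteinProjective M ∧
    IsGorensteinProjective N ∧ Nonempty (L ≃ₗ[A] M × N)) ?_ ?_ ⟨M, N, hM, hN, ⟨.refl _ _⟩⟩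
  · rintro L ⟨M, N, hM, hN, ⟨e⟩⟩
    obtain ⟨M', hM', P, i, p, h⟩ := hM.exists_cosyzygy
    obtain ⟨N', hN', Q, j, q, h'⟩ := hN.exists_cosyzygy
    exact ⟨FGModuleCat.of A (M' × N'), ⟨M', N', hM', hN', ⟨.refl _ _⟩⟩,
      FGModuleCat.of A (P × Q), _, _, (h.prodMap h').comp_equiv e⟩
  · rintro L ⟨M, N, hM, hN, ⟨e⟩⟩
    obtain ⟨M', hM', P, i, p, h⟩ := hM.exists_syzygy
    obtain ⟨N', hN', Q, j, q, h'⟩ := hN.exists_syzygy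
    exact ⟨FGModuleCat.of A (M' × N'), ⟨M', N', hM', hN', ⟨.refl _ _⟩⟩,
      FGModuleCat.of A (P × Q), _, _, (h.prodMap h').equiv_comp e.symm⟩

/-- Direct summands of Gorenstein projective modules are Gorenstein projective. By Schanuel's lemma,
the class of modules `C` such that `C × D` is Gorenstein projective for some `D` is closed under
suitable syzygies and cosyzygies, so that `IsGorensteinProjective.of_class` applies. -/
lemma IsGorensteinProjective.of_prod {C D : FGModuleCat.{u} A}
    (h : IsGorensteinProjective (FGModuleCat.of A (C × D))) : IsGorensteinProjective C := by
  refine of_class (fun C ↦ ∃ D : FGModuleCat.{u} A,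
    IsGorensteinProjective (FGModuleCat.of A (C × D))) ?_ ?_ ⟨D, h⟩
  · rintro C ⟨D, hCD⟩
    obtain ⟨N, hN, P, i, p, h⟩ := hCD.exists_cosyzygy
    have h₁ := h.restrict_fst
    have h₂ := (h.comp_equiv (LinearEquiv.prodComm A D C)).restrict_fst
    have := h.projective
    obtain ⟨e⟩ := h.cokernel_prod_equiv (h₁.prodMap h₂)
    have hPP := IsGorensteinProjective.of_projective (FGModuleCat.of A (P × P))
    refine ⟨FGModuleCat.of A (P ⧸ LinearMap.range (i ∘ₗ LinearMap.inl A C D)),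
      ⟨FGModuleCat.of A ((P ⧸ LinearMap.range (i ∘ₗ
        (LinearEquiv.prodComm A D C).toLinearMap ∘ₗ LinearMap.inl A D C)) × P), ?_⟩, P, _, _, h₁⟩
    exact (hN.prod hPP).of_equiv (e ≪≫ₗ LinearEquiv.prodComm A _ _ ≪≫ₗ
      LinearEquiv.prodAssoc A _ _ _)
  · rintro C ⟨D, hCD⟩
    obtain ⟨N, hN, P, i, p, h⟩ := hCD.exists_syzygy
    have := h.projective
    let p₁ : P →ₗ[A] C := LinearMap.fst A C D ∘ₗ p
    let p₂ : P →ₗ[A] D := LinearMap.snd A C D ∘ₗ p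
    have hp₁ : Function.Surjective p₁ := Prod.fst_surjective.comp h.surjective
    have hp₂ : Function.Surjective p₂ := Prod.snd_surjective.comp h.surjective
    let j₁ := (LinearMap.ker p₁).subtype
    let j₂ := (LinearMap.ker p₂).subtype
    have hj : Function.Injective (j₁.prodMap j₂) :=
      Subtype.val_injective.prodMap Subtype.val_injective
    have hjp : Function.Exact (j₁.prodMap j₂) (p₁.prodMap p₂) := by
      rintro ⟨x, y⟩
      simp [j₁, j₂]
    have hp := hp₁.prodMap hp₂
    obtain ⟨e⟩ := nonempty_ker_prod_equiv h.injective hj h.exact hjp h.surjective hp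
    have h' := h.of_presentation hj hjp hp
    have hPP := IsGorensteinProjective.of_projective (FGModuleCat.of A (P × P))
    refine ⟨FGModuleCat.of A (LinearMap.ker p₁),
      ⟨FGModuleCat.of A (LinearMap.ker p₂ × P), ?_⟩, P, j₁, p₁, ?_⟩
    · exact (hN.prod hPP).of_equiv (e ≪≫ₗ LinearEquiv.prodComm A _ _ ≪≫ₗ
        LinearEquiv.prodAssoc A _ _ _)
    · refine ⟨inferInstance, Subtype.val_injective, LinearMap.exact_subtype_ker_map p₁, hp₁,
        fun Q _ _ _ _ f ↦ ?_⟩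
      obtain ⟨g, hg⟩ := h'.extend Q (f ∘ₗ LinearMap.fst A _ _)
      refine ⟨g ∘ₗ LinearMap.inl A P P, ?_⟩
      ext x
      have := LinearMap.congr_fun hg (x, 0)
      simpa using this

end GorensteinProjectives

/-! ### Finite CM-type and approximations -/

section FiniteType

variable {A : Type u} [Ring A]

lemma FGModuleCat.isZero_iff_subsingleton (M : FGModuleCat.{u} A) : IsZero M ↔ Subsingleton M := by
  constructor
  · intro h
    refine ⟨fun x y ↦ ?_⟩
    have := FGModuleCat.congr_hom (h.eq_of_src (𝟙 M) 0)
    exact (this x).trans (this y).symm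
  · intro h
    rw [IsZero.iff_id_eq_zero]
    ext x
    exact Subsingleton.elim (α := M) _ _

/-- The categorical biproduct of two finitely generated modules is their product module. -/
noncomputable def FGModuleCat.biprodEquiv (M N : FGModuleCat.{u} A) :
    (M ⊞ N : FGModuleCat.{u} A) ≃ₗ[A] M × N :=
  LinearEquiv.ofLinearMap
    ((biprod.fst : M ⊞ N ⟶ M).hom.hom.prod (biprod.snd : M ⊞ N ⟶ N).hom.hom)
    ((biprod.inl : M ⟶ M ⊞ N).hom.hom.coprod (biprod.inr : N ⟶ M ⊞ N).hom.hom)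
    (by
      have h₁ (x : M) : (biprod.fst : M ⊞ N ⟶ M).hom.hom
          ((biprod.inl : M ⟶ M ⊞ N).hom.hom x) = x :=
        FGModuleCat.congr_hom biprod.inl_fst x
      have h₂ (x : N) : (biprod.snd : M ⊞ N ⟶ N).hom.hom
          ((biprod.inr : N ⟶ M ⊞ N).hom.hom x) = x :=
        FGModuleCat.congr_hom biprod.inr_snd x
      have h₃ (x : M) : (biprod.snd : M ⊞ N ⟶ N).hom.hom
          ((biprod.inl : M ⟶ M ⊞ N).hom.hom x) = 0 :=
        FGModuleCat.congr_hom biprod.inl_snd x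
      have h₄ (x : N) : (biprod.fst : M ⊞ N ⟶ M).hom.hom
          ((biprod.inr : N ⟶ M ⊞ N).hom.hom x) = 0 :=
        FGModuleCat.congr_hom biprod.inr_fst x
      ext x <;> simp [h₁, h₂, h₃, h₄])
    (by
      have h := congrArg (fun t ↦ t.hom.hom) (biprod.total (X := M) (Y := N))
      ext x
      exact LinearMap.congr_fun h x)

lemma FGModuleCat.biproduct_π_ι_apply {m : ℕ} (G : Fin m → FGModuleCat.{u} A) (i j : Fin m)
    (x : G i) : (biproduct.π G j).hom.hom ((biproduct.ι G i).hom.hom x) =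
      (Pi.single i x : ∀ i, G i) j := by
  by_cases hij : i = j
  · subst hij
    have := congrArg (fun t ↦ t.hom.hom) (biproduct.ι_π_self G i)
    rw [Pi.single_eq_same]
    exact LinearMap.congr_fun this x
  · have := congrArg (fun t ↦ t.hom.hom) (biproduct.ι_π_ne G hij)
    rw [Pi.single_eq_of_ne (Ne.symm hij)]
    exact LinearMap.congr_fun this x

/-- The categorical biproduct of a finite family of finitely generated modules is their product
module. -/
noncomputable def FGModuleCat.biproductEquiv {m : ℕ} (G : Fin m → FGModuleCat.{u} A) :
    (⨁ G : FGModuleCat.{u} A) ≃ₗ[A] (∀ i, G i) :=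
  LinearEquiv.ofBijective (LinearMap.pi fun i ↦ (biproduct.π G i).hom.hom) <| by
    constructor
    · rw [injective_iff_map_eq_zero]
      intro x hx
      -- an element is a morphism from `A`, so it is determined by its components
      have : FGModuleCat.ofHom (LinearMap.toSpanSingleton A _ x) = (0 : _ ⟶ ⨁ G) := by
        refine biproduct.hom_ext _ _ fun i ↦ ?_
        rw [zero_comp]
        ext
        change (biproduct.π G i).hom.hom ((1 : A) • x) = 0
        rw [one_smul]
        exact congrFun hx i
      have := FGModuleCat.congr_hom this (1 : A)
      exact (one_smul A x).symm.trans this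
    · intro v
      refine ⟨∑ i, (biproduct.ι G i).hom.hom (v i), ?_⟩
      ext j
      rw [map_sum, Finset.sum_apply]
      simp only [LinearMap.pi_apply, biproduct_π_ι_apply]
      exact Fintype.sum_pi_single _ _

lemma IsGorensteinProjective.of_isZero {M : FGModuleCat.{u} A} (hM : IsZero M) :
    IsGorensteinProjective M :=
  have := (FGModuleCat.isZero_iff_subsingleton M).1 hM
  have : Module.Projective A M := inferInstance
  .of_projective M

variable [IsNoetherianRing A]

lemma IsGorensteinProjective.pi {m : ℕ} (G : Fin m → FGModuleCat.{u} A)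
    (hG : ∀ i, IsGorensteinProjective (G i)) :
    IsGorensteinProjective (FGModuleCat.of A (∀ i, G i)) := by
  induction m with
  | zero =>
    exact .of_isZero ((FGModuleCat.isZero_iff_subsingleton _).2
      (inferInstanceAs (Subsingleton (∀ i, G i))))
  | succ m ih =>
    exact ((hG 0).prod (ih (fun i ↦ G i.succ) fun i ↦ hG _)).of_equiv
      (Fin.consLinearEquiv A (fun i ↦ (G i : Type u)))

lemma IsGorensteinProjective.biproduct {m : ℕ} (G : Fin m → FGModuleCat.{u} A)
    (hG : ∀ i, IsGorensteinProjective (G i)) : IsGorensteinProjective (⨁ G) :=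
  (IsGorensteinProjective.pi G hG).of_equiv (FGModuleCat.biproductEquiv G).symm

lemma IsGorensteinProjective.of_biprod {M N : FGModuleCat.{u} A}
    (h : IsGorensteinProjective (M ⊞ N)) : IsGorensteinProjective M :=
  (h.of_equiv (N := FGModuleCat.of A (M × N)) (FGModuleCat.biprodEquiv M N)).of_prod

/-- Over an artinian ring, a property of Gorenstein projective modules which is stable under
isomorphisms and finite direct sums only has to be checked on the indecomposable ones. -/
lemma IsGorensteinProjective.induction_indecomposable [IsArtinianRing A]
    (T : FGModuleCat.{u} A → Prop) (h₀ : ∀ M, IsZero M → T M)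
    (hsum : ∀ M M₁ M₂, (M ≅ M₁ ⊞ M₂) → T M₁ → T M₂ → T M)
    (hT : ∀ M, Indecomposable M → IsGorensteinProjective M → T M)
    (M : FGModuleCat.{u} A) (hM : IsGorensteinProjective M) : T M := by
  by_cases hz : IsZero M
  · exact h₀ M hz
  by_cases hi : Indecomposable M
  · exact hT M hi hM
  simp only [Indecomposable, hz, not_false_eq_true, true_and, not_forall, not_or] at hi
  obtain ⟨M₁, M₂, e, h₁, h₂⟩ := hi
  have hlen (N : FGModuleCat.{u} A) : Module.length A N ≠ ⊤ :=
    have := isNoetherian_of_isNoetherianRing_of_finite A N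
    Module.length_ne_top
  have hM' : IsGorensteinProjective (M₁ ⊞ M₂) := hM.of_equiv (FGModuleCat.isoToLinearEquiv e)
  have hadd : Module.length A M = Module.length A M₁ + Module.length A M₂ := by
    rw [← Module.length_prod]
    exact (FGModuleCat.isoToLinearEquiv e ≪≫ₗ FGModuleCat.biprodEquiv M₁ M₂).length_eq
  have hpos (N : FGModuleCat.{u} A) (hN : ¬ IsZero N) : 0 < Module.length A N := by
    rw [FGModuleCat.isZero_iff_subsingleton, not_subsingleton_iff_nontrivial] at hN
    exact Module.length_pos
  have hl₁ : (Module.length A M₁).toNat < (Module.length A M).toNat := by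
    rw [hadd, ENat.toNat_add (hlen _) (hlen _)]
    have := hpos M₂ h₂
    rw [← ENat.natCast_toNat (hlen M₂)] at this
    norm_cast at this
    lia
  have hl₂ : (Module.length A M₂).toNat < (Module.length A M).toNat := by
    rw [hadd, ENat.toNat_add (hlen _) (hlen _)]
    have := hpos M₁ h₁
    rw [← ENat.natCast_toNat (hlen M₁)] at this
    norm_cast at this
    lia
  exact hsum M M₁ M₂ e
    (induction_indecomposable T h₀ hsum hT M₁ hM'.of_biprod)
    (induction_indecomposable T h₀ hsum hT M₂
      (hM'.of_equiv (FGModuleCat.isoToLinearEquiv (biprod.braiding M₁ M₂))).of_biprod)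
termination_by (Module.length A M).toNat

/-- Finitely many maps from Gorenstein projective modules to `X` factor through a single one. -/
lemma exists_gorensteinProjective_factor (X : FGModuleCat.{u} A)
    (S : Set (Σ M : FGModuleCat.{u} A, (M ⟶ X))) (hS : S.Finite)
    (hS' : ∀ x ∈ S, IsGorensteinProjective x.1) :
    ∃ (E : FGModuleCat.{u} A) (p : E ⟶ X), IsGorensteinProjective E ∧
      ∀ x ∈ S, ∃ g : x.1 ⟶ E, g ≫ p = x.2 := by
  induction S, hS using Set.Finite.induction_on with
  | empty => exact ⟨0, 0, .of_isZero (isZero_zero _), by simp⟩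
  | @insert a s ha hs ih =>
    obtain ⟨E, p, hE, h⟩ := ih fun x hx ↦ hS' x (Set.mem_insert_of_mem _ hx)
    refine ⟨a.1 ⊞ E, biprod.desc a.2 p,
      ((hS' a (Set.mem_insert _ _)).prod hE).of_equiv (FGModuleCat.biprodEquiv _ _).symm, ?_⟩
    rintro x (rfl | hx)
    · exact ⟨biprod.inl, by simp⟩
    · obtain ⟨g, hg⟩ := h x hx
      exact ⟨g ≫ biprod.inr, by simpa using hg⟩

omit [IsNoetherianRing A] in
/-- Over a finite-dimensional algebra, a map `p` lifts all maps `M ⟶ X` as soon as it lifts those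
in a suitable finite set, namely a basis of `Hom(M, X)`. -/
lemma exists_finite_lifting_test (k : Type*) [Field k] [Algebra k A] [FiniteDimensional k A]
    (M X : FGModuleCat.{u} A) :
    ∃ s : Set (M ⟶ X), s.Finite ∧ ∀ (E : FGModuleCat.{u} A) (p : E ⟶ X),
      (∀ f ∈ s, ∃ g : M ⟶ E, g ≫ p = f) → ∀ f : M ⟶ X, ∃ g : M ⟶ E, g ≫ p = f := by
  let (N : FGModuleCat.{u} A) : Module k N := Module.compHom N (algebraMap k A)
  have (N : FGModuleCat.{u} A) : IsScalarTower k A N := ⟨fun a b x ↦ by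
    rw [Algebra.smul_def, mul_smul]
    rfl⟩
  have (N : FGModuleCat.{u} A) : SMulCommClass A k N := IsScalarTower.to_smulCommClass'
  have (N : FGModuleCat.{u} A) : Module.Finite k N := Module.Finite.trans A N
  have : Module.Finite k (M →ₗ[A] X) :=
    Module.Finite.of_injective (LinearMap.restrictScalarsₗ k A M X k)
      (LinearMap.restrictScalars_injective k)
  obtain ⟨s, hs⟩ := (inferInstance : Module.Finite k (M →ₗ[A] X)).fg_top
  refine ⟨(fun t ↦ FGModuleCat.ofHom t) '' (s : Set (M →ₗ[A] X)), s.finite_toSet.image _, ?_⟩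
  intro E p hp
  let V : Submodule k (M →ₗ[A] X) :=
    { carrier := {f | ∃ g : M →ₗ[A] E, p.hom.hom ∘ₗ g = f}
      zero_mem' := ⟨0, by simp⟩
      add_mem' := by
        rintro _ _ ⟨g, rfl⟩ ⟨g', rfl⟩
        exact ⟨g + g', LinearMap.comp_add _ _ _⟩
      smul_mem' := by
        rintro c _ ⟨g, rfl⟩
        refine ⟨c • g, ?_⟩
        ext x
        exact p.hom.hom.map_smul (algebraMap k A c) (g x) }
  have hV : V = ⊤ := by
    rw [eq_top_iff, ← hs, Submodule.span_le]
    intro f hf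
    obtain ⟨g, hg⟩ := hp _ ⟨f, hf, rfl⟩
    exact ⟨g.hom.hom, congrArg (fun t ↦ t.hom.hom) hg⟩
  intro f
  obtain ⟨g, hg⟩ : f.hom.hom ∈ V := by simp [hV]
  exact ⟨FGModuleCat.ofHom g, FGModuleCat.hom_ext hg⟩

/-- Over an algebra of finite CM-type, every module has a surjective right approximation by a
Gorenstein projective module. -/
theorem exists_gorensteinProjective_approximation (k : Type*) [Field k] [Algebra k A]
    [FiniteDimensional k A] {m : ℕ} {G : Fin m → FGModuleCat.{u} A}
    (hG : IsIndecGorensteinProjectiveList G) (X : FGModuleCat.{u} A) :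
    ∃ (E : FGModuleCat.{u} A) (p : E ⟶ X), IsGorensteinProjective E ∧
      Function.Surjective p.hom.hom ∧
      ∀ (P : FGModuleCat.{u} A), IsGorensteinProjective P → ∀ f : P ⟶ X,
        ∃ g : P ⟶ E, g ≫ p = f := by
  have : IsArtinianRing A := IsArtinianRing.of_finite k A
  choose s hs hs' using fun i ↦ exists_finite_lifting_test k (G i) X
  obtain ⟨E, p, hE, hp⟩ := exists_gorensteinProjective_factor X
    (⋃ i, Sigma.mk (G i) '' s i) (Set.finite_iUnion fun i ↦ (hs i).image _) (by
      intro x hx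
      obtain ⟨i, f, -, rfl⟩ := Set.mem_iUnion.1 hx
      exact hG.gorensteinProjective i)
  have hlift (P : FGModuleCat.{u} A) (hP : IsGorensteinProjective P) :
      ∀ f : P ⟶ X, ∃ g : P ⟶ E, g ≫ p = f := by
    refine IsGorensteinProjective.induction_indecomposable
      (fun P ↦ ∀ f : P ⟶ X, ∃ g : P ⟶ E, g ≫ p = f) ?_ ?_ ?_ P hP
    · exact fun M hM f ↦ ⟨0, hM.eq_of_src _ _⟩
    · intro M M₁ M₂ e h₁ h₂ f
      obtain ⟨g₁, hg₁⟩ := h₁ (biprod.inl ≫ e.inv ≫ f)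
      obtain ⟨g₂, hg₂⟩ := h₂ (biprod.inr ≫ e.inv ≫ f)
      refine ⟨e.hom ≫ biprod.desc g₁ g₂, ?_⟩
      rw [Category.assoc, ← Iso.eq_inv_comp]
      apply biprod.hom_ext' <;> simp [hg₁, hg₂]
    · intro M hM hM' f
      obtain ⟨i, ⟨e⟩⟩ := hG.complete M hM hM'
      obtain ⟨g, hg⟩ := hs' i E p
        (fun f hf ↦ hp ⟨G i, f⟩ (Set.mem_iUnion.2 ⟨i, f, hf, rfl⟩)) (e.inv ≫ f)
      exact ⟨e.hom ≫ g, by simp [hg]⟩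
  -- `p` is surjective because `A` itself is Gorenstein projective
  refine ⟨E, p, hE, fun x ↦ ?_, hlift⟩
  obtain ⟨g, hg⟩ := hlift (FGModuleCat.of A A) (.of_projective _)
    (FGModuleCat.ofHom (LinearMap.toSpanSingleton A X x))
  refine ⟨g.hom.hom (1 : A), ?_⟩
  have := FGModuleCat.congr_hom hg (1 : A)
  exact this.trans (one_smul A x)

end FiniteType

/-! ### Gorenstein projective resolutions -/

section Resolutions

variable {A : Type u} [Ring A]

lemma HasGorensteinProjectiveResolution.zero {M : FGModuleCat.{u} A}
    (hM : IsGorensteinProjective M) : HasGorensteinProjectiveResolution M 0 := by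
  have h₀ : IsGorensteinProjective (FGModuleCat.of A PUnit.{u + 1}) := .of_projective _
  refine ⟨fun i ↦ Nat.casesOn i M fun _ ↦ FGModuleCat.of A PUnit, fun i ↦ 0, 𝟙 M,
    fun i ↦ ?_, fun i hi ↦ ?_, Function.surjective_id, fun x ↦ ?_, fun i x ↦ ?_⟩
  · cases i
    exacts [hM, h₀]
  · obtain _ | i := i
    · lia
    · exact inferInstanceAs (Subsingleton PUnit.{u + 1})
  · exact ⟨fun h ↦ ⟨PUnit.unit, h.symm⟩, fun ⟨_, h⟩ ↦ h.symm⟩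
  · exact ⟨fun h ↦ ⟨PUnit.unit, rfl⟩, fun _ ↦ rfl⟩

lemma HasGorensteinProjectiveResolution.succ {K E X : FGModuleCat.{u} A} {n : ℕ}
    (hK : HasGorensteinProjectiveResolution K n) (hE : IsGorensteinProjective E)
    (i : K ⟶ E) (p : E ⟶ X) (hi : Function.Injective i.hom.hom)
    (hip : Function.Exact i.hom.hom p.hom.hom) (hp : Function.Surjective p.hom.hom) :
    HasGorensteinProjectiveResolution X (n + 1) := by
  obtain ⟨G, d, ε, hG, hn, hε, h₀, h⟩ := hK
  refine ⟨fun j ↦ Nat.casesOn j E G, fun j ↦ Nat.casesOn j (ε ≫ i) d, p,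
    fun j ↦ ?_, fun j hj ↦ ?_, hp, fun x ↦ ?_, fun j ↦ ?_⟩
  · cases j
    exacts [hE, hG _]
  · obtain _ | j := j
    · lia
    · exact hn j (by lia)
  · rw [hip x]
    constructor
    · rintro ⟨y, rfl⟩
      obtain ⟨z, rfl⟩ := hε y
      exact ⟨z, rfl⟩
    · rintro ⟨z, rfl⟩
      exact ⟨_, rfl⟩
  · cases j with
    | zero =>
      intro x
      refine Iff.trans ?_ (h₀ x)
      change i.hom.hom (ε.hom.hom x) = 0 ↔ ε.hom.hom x = 0
      exact map_eq_zero_iff _ hi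
    | succ j => exact h j

end Resolutions

/-! ### Ghost maps -/

section Ghosts

variable {T : Type*} [Category* T] [HasZeroObject T] [HasShift T ℤ] [Preadditive T]
  [∀ n : ℤ, (shiftFunctor T n).Additive] [Pretriangulated T]

/-- The map `f : X ⟶ Y` annihilates the class `P` if every composite `W ⟶ X⟦j⟧ ⟶ Y⟦j⟧` with a shift
of `f` is zero, for `W` in `P` and `j : ℤ`. All shifts of `f` are included because the levels
`⟨M⟩_n` are stable under shifts; a map annihilating `⟨M⟩_1` is an `M`-ghost. -/
def Annihilates (P : ObjectProperty T) {X Y : T} (f : X ⟶ Y) : Prop :=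
  ∀ ⦃W : T⦄, P W → ∀ (j : ℤ) (g : W ⟶ X⟦j⟧), g ≫ f⟦j⟧' = 0

lemma Annihilates.addClosure {P : ObjectProperty T} {X Y : T} {f : X ⟶ Y}
    (hf : Annihilates P f) : Annihilates (addClosure P) f := by
  rintro W ⟨m, V, hV, Z, ⟨e⟩⟩ j g
  have h : (biprod.fst : W ⊞ Z ⟶ W) ≫ g ≫ f⟦j⟧' = 0 := by
    rw [← cancel_epi e.inv, comp_zero]
    refine biproduct.hom_ext' _ _ fun i ↦ ?_
    simpa using hf (hV i) j (biproduct.ι V i ≫ e.inv ≫ biprod.fst ≫ g)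
  simpa using biprod.inl ≫= h

lemma Annihilates.extensionProduct {P Q : ObjectProperty T} {X Y Z : T} {f : X ⟶ Y} {g : Y ⟶ Z}
    (hf : Annihilates P f) (hg : Annihilates Q g) :
    Annihilates (ObjectProperty.extensionProduct P Q) (f ≫ g) := by
  rintro W ⟨W', W'', a, b, c, hT, hW', hW''⟩ j φ
  obtain ⟨ψ : W'' ⟶ Y⟦j⟧, hψ : φ ≫ f⟦j⟧' = b ≫ ψ⟩ := Triangle.yoneda_exact₂ _ hT (φ ≫ f⟦j⟧')
    ((Category.assoc _ _ _).symm.trans (hf hW' j (a ≫ φ)))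
  rw [Functor.map_comp, ← Category.assoc, hψ, Category.assoc]
  exact (_ ≫= hg hW'' j ψ).trans comp_zero

omit [HasZeroObject T] [∀ n : ℤ, (shiftFunctor T n).Additive] [Pretriangulated T] in
lemma Annihilates.shift {P : ObjectProperty T} {X Y : T} {f : X ⟶ Y} (hf : Annihilates P f)
    (n : ℤ) : Annihilates P (f⟦n⟧') := by
  intro W hW j g
  have := hf hW (n + j) (g ≫ (shiftFunctorAdd T n j).inv.app X)
  rw [← cancel_mono ((shiftFunctorAdd T n j).inv.app Y), zero_comp, Category.assoc]
  have nat := (shiftFunctorAdd T n j).inv.naturality f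
  dsimp at nat
  rw [nat, ← Category.assoc, this]

omit [HasZeroObject T] [∀ n : ℤ, (shiftFunctor T n).Additive] [Pretriangulated T] in
lemma comp_shift_zero_eq_zero {W X Y : T} {f : X ⟶ Y} (g : W ⟶ X⟦(0 : ℤ)⟧)
    (h : (g ≫ (shiftFunctorZero T ℤ).hom.app X) ≫ f = 0) : g ≫ f⟦(0 : ℤ)⟧' = 0 := by
  have nat : f⟦(0 : ℤ)⟧' ≫ (shiftFunctorZero T ℤ).hom.app Y =
    (shiftFunctorZero T ℤ).hom.app X ≫ f := (shiftFunctorZero T ℤ).hom.naturality f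
  rw [← cancel_mono ((shiftFunctorZero T ℤ).hom.app Y), zero_comp, Category.assoc, nat,
    ← Category.assoc, h]

lemma annihilates_generatedLevel_one {M X Y : T} {f : X ⟶ Y}
    (h : ∀ (j : ℤ) (g : M ⟶ X⟦j⟧), g ≫ f⟦j⟧' = 0) :
    Annihilates (generatedLevel M 1) f := by
  rw [generatedLevel]
  refine Annihilates.addClosure ?_
  rintro W ⟨i, ⟨e⟩⟩ j g
  let α : M ≅ W⟦-i⟧ := (shiftShiftNeg M i).symm ≪≫ (shiftFunctor T (-i)).mapIso e.symm
  have hα := h (j + -i) (α.hom ≫ g⟦-i⟧' ≫ (shiftFunctorAdd T j (-i)).inv.app X)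
  have nat := (shiftFunctorAdd T j (-i)).inv.naturality f
  dsimp at nat
  apply (shiftFunctor T (-i)).map_injective
  rw [Functor.map_zero, ← cancel_epi α.hom, comp_zero,
    ← cancel_mono ((shiftFunctorAdd T j (-i)).inv.app Y), zero_comp, ← hα]
  simp [nat]

/-- The inductive step of the **ghost lemma**: a composite of `n` ghosts annihilates `⟨M⟩_n`. -/
lemma Annihilates.generatedLevel_comp {M X Y Z : T} {f : X ⟶ Y} {g : Y ⟶ Z} {n : ℕ}
    (hf : Annihilates (generatedLevel M 1) f) (hg : Annihilates (generatedLevel M (n + 1)) g) :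
    Annihilates (generatedLevel M (n + 2)) (f ≫ g) := by
  rw [generatedLevel]
  exact (hf.extensionProduct hg).addClosure

omit [HasZeroObject T] [∀ n : ℤ, (shiftFunctor T n).Additive] [Pretriangulated T] in
lemma Annihilates.comp {P : ObjectProperty T} {X Y Z : T} {f : X ⟶ Y} (hf : Annihilates P f)
    (g : Y ⟶ Z) : Annihilates P (f ≫ g) := by
  intro W hW j φ
  rw [Functor.map_comp, ← Category.assoc, hf hW j φ, zero_comp]

omit [HasZeroObject T] [∀ n : ℤ, (shiftFunctor T n).Additive] [Pretriangulated T] in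
lemma Annihilates.eq_zero {P : ObjectProperty T} {X Y : T} {f : X ⟶ Y} (hf : Annihilates P f)
    (hX : P X) : f = 0 := by
  have h := hf hX 0 ((shiftFunctorZero T ℤ).inv.app X)
  have nat : f ≫ (shiftFunctorZero T ℤ).inv.app Y = (shiftFunctorZero T ℤ).inv.app X ≫ f⟦(0 : ℤ)⟧' :=
    (shiftFunctorZero T ℤ).inv.naturality f
  rw [← cancel_mono ((shiftFunctorZero T ℤ).inv.app Y), nat, h, zero_comp]

end Ghosts

/-! ### Morphisms out of Gorenstein projective modules in the localization -/

section GorensteinDerived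

variable (A : Type u) [Ring A]

/-- The functor from `A-mod` to `K^b(A-mod)` sending a module to the complex concentrated in
degree `0`. -/
noncomputable def singleBounded :
    FGModuleCat.{u} A ⥤ HomotopyCategory.Bounded (FGModuleCat.{u} A) :=
  (HomotopyCategory.bounded _).lift
    (CochainComplex.singleFunctor _ 0 ⋙ HomotopyCategory.quotient _ _)
    fun X ↦ (toBoundedHomotopyCategory X).property

instance : (singleBounded A).Full where
  map_surjective {X Y} f := by
    obtain ⟨g, hg⟩ := (HomotopyCategory.quotient _ _).map_surjective f.hom
    obtain ⟨h, rfl⟩ := (CochainComplex.singleFunctor _ 0).map_surjective g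
    exact ⟨h, ObjectProperty.hom_ext _ hg⟩

instance : (singleBounded A).Additive where
  map_add {X Y f g} := by
    apply ObjectProperty.hom_ext
    exact (CochainComplex.singleFunctor _ 0 ⋙ HomotopyCategory.quotient _ _).map_add

variable {A}

/-- Two complexes concentrated in the same degree admit no nonzero homotopies, so `singleBounded` is
faithful. -/
lemma eq_zero_of_singleBounded_map_eq_zero {X Y : FGModuleCat.{u} A} (f : X ⟶ Y)
    (hf : (singleBounded A).map f = 0) : f = 0 := by
  have hf' : (HomotopyCategory.quotient _ _).map ((CochainComplex.singleFunctor _ 0).map f) =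
      (HomotopyCategory.quotient (FGModuleCat.{u} A) (.up ℤ)).map 0 := by
    rw [Functor.map_zero]
    exact congrArg (fun t ↦ t.hom) hf
  apply (CochainComplex.singleFunctor (FGModuleCat.{u} A) 0).map_injective
  rw [Functor.map_zero]
  have H := HomotopyCategory.homotopyOfEq _ _ hf'
  apply HomologicalComplex.from_single_hom_ext
  have := H.comm 0
  rw [dNext_eq _ (show (ComplexShape.up ℤ).Rel 0 1 by simp),
    prevD_eq _ (show (ComplexShape.up ℤ).Rel (-1) 0 by simp)] at this
  rw [this]
  simp [CochainComplex.singleFunctor, CochainComplex.singleFunctors]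
  erw [add_zero, add_zero]
  rfl

lemma eq_zero_of_isZero_X {X : FGModuleCat.{u} A}
    {K : HomotopyCategory (FGModuleCat.{u} A) (.up ℤ)} (hK : IsZero (K.as.X 0))
    (f : ((singleBounded A).obj X).obj ⟶ K) : f = 0 := by
  obtain ⟨K⟩ := K
  obtain ⟨g : (CochainComplex.singleFunctor _ 0).obj X ⟶ K, rfl⟩ :=
    (HomotopyCategory.quotient _ _).map_surjective f
  have : g = 0 := HomologicalComplex.from_single_hom_ext (hK.eq_of_tgt _ _)
  rw [this]
  exact Functor.map_zero _ _ _

lemma exists_eq_of_gpAcyclic {P : FGModuleCat.{u} A} (hP : IsGorensteinProjective P)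
    {K : HomotopyCategory (FGModuleCat.{u} A) (.up ℤ)} (hK : gpAcyclic A K)
    (f : P ⟶ K.as.X 0) (hf : f ≫ K.as.d 0 1 = 0) :
    ∃ g : P ⟶ K.as.X (-1), g ≫ K.as.d (-1) 0 = f := by
  have h := hK P hP 0
  rw [HomologicalComplex.exactAt_iff' _ (-1) 0 1 (by simp) (by simp),
    ShortComplex.ab_exact_iff] at h
  exact h f hf

open CochainComplex.HomComplex in
/-- A morphism from a Gorenstein projective `P` to a complex `K` is a cocycle of `Hom(P, K)`, which is
a boundary if `K` is `gp`-acyclic. -/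
lemma singleBounded_leftOrthogonal {P : FGModuleCat.{u} A} (hP : IsGorensteinProjective P) :
    (gpAcyclicBounded A).leftOrthogonal ((singleBounded A).obj P) := by
  rintro ⟨⟨K⟩, hK'⟩ f (hK : gpAcyclic A ⟨K⟩)
  apply ObjectProperty.hom_ext
  obtain ⟨g : (CochainComplex.singleFunctor _ 0).obj P ⟶ K, hg⟩ :=
    (HomotopyCategory.quotient _ _).map_surjective f.hom
  rw [← hg]
  obtain ⟨φ, hφ, hφ'⟩ := (Cocycle.ofHom g).fromSingleMk_surjective 0 (by simp) 1 (by simp)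
  obtain ⟨γ, hγ⟩ := exists_eq_of_gpAcyclic hP hK φ hφ
  have H : Nonempty (Homotopy g 0) := by
    refine ⟨(Cochain.equivHomotopy g 0).symm ⟨Cochain.fromSingleMk γ (by simp), ?_⟩⟩
    rw [Cochain.δ_fromSingleMk _ _ 0 0 (by simp), Cochain.ofHom_zero, add_zero]
    have := congrArg Subtype.val hφ'
    simp [hγ] at this ⊢
    exact this.symm
  exact (HomotopyCategory.eq_of_homotopy _ _ H.some).trans (Functor.map_zero _ _ _)

variable {D : Type*} [Category* D]
  (L : HomotopyCategory.Bounded (FGModuleCat.{u} A) ⥤ D) [L.IsLocalization (gpAcyclicBounded A).trW]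

lemma localization_map_bijective {P : FGModuleCat.{u} A} (hP : IsGorensteinProjective P)
    (K : HomotopyCategory.Bounded (FGModuleCat.{u} A)) :
    Function.Bijective (L.map : ((singleBounded A).obj P ⟶ K) → _) :=
  (singleBounded_leftOrthogonal hP).map_bijective_of_isTriangulated L K

lemma exists_map_eq {P X : FGModuleCat.{u} A} (hP : IsGorensteinProjective P)
    (f : (singleBounded A ⋙ L).obj P ⟶ (singleBounded A ⋙ L).obj X) :
    ∃ g : P ⟶ X, (singleBounded A ⋙ L).map g = f := by
  obtain ⟨g, rfl⟩ := (localization_map_bijective L hP _).2 f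
  obtain ⟨h, rfl⟩ := (singleBounded A).map_surjective g
  exact ⟨h, rfl⟩

variable [Preadditive D] [L.Additive]

/-- The functor from modules to the localization is faithful: a linear map is detected on maps from
`A`, and `A` is Gorenstein projective. -/
lemma eq_zero_of_map_eq_zero {X Y : FGModuleCat.{u} A} (f : X ⟶ Y)
    (hf : (singleBounded A ⋙ L).map f = 0) : f = 0 := by
  ext x
  have h₀ : FGModuleCat.ofHom (LinearMap.toSpanSingleton A X x) ≫ f = 0 := by
    apply eq_zero_of_singleBounded_map_eq_zero
    apply (localization_map_bijective L (.of_projective (FGModuleCat.of A A)) _).1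
    rw [L.map_zero, Functor.map_comp, L.map_comp]
    exact (_ ≫= hf).trans comp_zero
  have := FGModuleCat.congr_hom h₀ (1 : A)
  change f.hom.hom ((1 : A) • x) = 0 at this
  rwa [one_smul] at this

variable [HasShift D ℤ] [L.CommShift ℤ]

lemma eq_zero_of_ne_zero {P X : FGModuleCat.{u} A} (hP : IsGorensteinProjective P) {i : ℤ}
    (hi : i ≠ 0) (f : (singleBounded A ⋙ L).obj P ⟶ ((singleBounded A ⋙ L).obj X)⟦i⟧) :
    f = 0 := by
  rw [← cancel_mono ((L.commShiftIso i).inv.app _), zero_comp]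
  obtain ⟨g, hg⟩ := (localization_map_bijective L hP (((singleBounded A).obj X)⟦i⟧)).2
    (f ≫ (L.commShiftIso i).inv.app _)
  rw [← hg]
  have : g = 0 := by
    apply ObjectProperty.hom_ext
    let e := ((HomotopyCategory.bounded (FGModuleCat.{u} A)).ι.commShiftIso i).app
      ((singleBounded A).obj X)
    have hX : IsZero ((((singleBounded A).obj X).obj⟦i⟧).as.X 0) := by
      change IsZero ((((HomotopyCategory.quotient _ _).obj
        ((CochainComplex.singleFunctor _ 0).obj X))⟦i⟧).as.X 0)
      rw [HomotopyCategory.shift_quotient_obj]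
      exact HomologicalComplex.isZero_single_obj_X (.up ℤ) 0 X (0 + i) (by lia)
    have := eq_zero_of_isZero_X hX (g.hom ≫ e.hom)
    rw [← cancel_mono e.hom]
    exact this.trans zero_comp.symm
  rw [this, L.map_zero]

end GorensteinDerived

/-! ### Proper exact sequences give distinguished triangles -/

section ProperSequences

variable {A : Type u} [Ring A]

/-- A short exact sequence of modules which stays exact under `Hom(P, -)` for every Gorenstein
projective module `P`. -/
structure IsProperExact (S : ShortComplex (FGModuleCat.{u} A)) : Prop where
  injective : Function.Injective S.f.hom.hom
  exact : Function.Exact S.f.hom.hom S.g.hom.hom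
  surjective : Function.Surjective S.g.hom.hom
  exists_lift (P : FGModuleCat.{u} A) (hP : IsGorensteinProjective P) (f : P ⟶ S.X₃) :
    ∃ g : P ⟶ S.X₂, g ≫ S.g = f

lemma IsProperExact.shortExact_map {S : ShortComplex (FGModuleCat.{u} A)} (hS : IsProperExact S)
    {P : FGModuleCat.{u} A} (hP : IsGorensteinProjective P) :
    (S.map (preadditiveCoyoneda.obj (Opposite.op P))).ShortExact where
  exact := by
    rw [ShortComplex.ab_exact_iff]
    intro (f : P ⟶ S.X₂) (hf : f ≫ S.g = 0)
    let e := LinearEquiv.ofInjective S.f.hom.hom hS.injective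
    let g : P →ₗ[A] S.X₁ := e.symm.toLinearMap ∘ₗ f.hom.hom.codRestrict (LinearMap.range S.f.hom.hom)
      fun x ↦ (hS.exact _).1 (FGModuleCat.congr_hom hf x)
    refine ⟨FGModuleCat.ofHom g, ?_⟩
    change FGModuleCat.ofHom g ≫ S.f = f
    ext x
    exact congrArg Subtype.val (e.apply_symm_apply _)
  mono_f := by
    rw [AddCommGrpCat.mono_iff_injective, injective_iff_map_eq_zero]
    intro (f : P ⟶ S.X₁) (hf : f ≫ S.f = 0)
    exact FGModuleCat.hom_ext (LinearMap.ext fun x ↦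
      hS.injective ((FGModuleCat.congr_hom hf x).trans (map_zero _).symm))
  epi_g := by
    rw [AddCommGrpCat.epi_iff_surjective]
    exact fun f ↦ hS.exists_lift P hP f

variable [IsNoetherianRing A]

lemma IsProperExact.quasiIso_map_descShortComplex {S : ShortComplex (FGModuleCat.{u} A)}
    (hS : IsProperExact S) {P : FGModuleCat.{u} A} (hP : IsGorensteinProjective P) :
    QuasiIso (((preadditiveCoyoneda.obj (Opposite.op P)).mapHomologicalComplex (.up ℤ)).map
      (CochainComplex.mappingCone.descShortComplex
        (S.map (CochainComplex.singleFunctor (FGModuleCat.{u} A) 0)))) := by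
  let H := preadditiveCoyoneda.obj (Opposite.op P)
  have h₁ : ((S.map (CochainComplex.singleFunctor _ 0)).map
      (H.mapHomologicalComplex (.up ℤ))).ShortExact := by
    have h₂ : ((S.map H).map (CochainComplex.singleFunctor _ 0)).ShortExact :=
      (hS.shortExact_map hP).map_of_exact (HomologicalComplex.single _ (.up ℤ) 0)
    exact ShortComplex.shortExact_of_iso
      (ShortComplex.mapNatIso S (H.mapCochainComplexSingleFunctor 0)).symm h₂
  have h₃ := CochainComplex.mappingCone.quasiIso_descShortComplex h₁
  let e := CochainComplex.mappingCone.mapHomologicalComplexIso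
    (S.map (CochainComplex.singleFunctor (FGModuleCat.{u} A) 0)).f H
  have he : QuasiIso e.hom := inferInstance
  have := (quasiIso_iff_comp_left e.hom (CochainComplex.mappingCone.descShortComplex
    ((S.map (CochainComplex.singleFunctor _ 0)).map (H.mapHomologicalComplex (.up ℤ))))).2 h₃
  rwa [CochainComplex.mappingCone.mapHomologicalComplexIso_hom_descShortComplex] at this

/-- For a proper exact sequence `0 ⟶ K ⟶ E ⟶ X ⟶ 0`, the canonical map from the cone of `K ⟶ E` to
`X` is inverted in the localization. The cone is only required up to isomorphism in the homotopy
category, to allow for any choice of it in `K^b`. -/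
lemma IsProperExact.trW {S : ShortComplex (FGModuleCat.{u} A)} (hS : IsProperExact S)
    {C : HomotopyCategory.Bounded (FGModuleCat.{u} A)}
    (e : C.obj ≅ (HomotopyCategory.quotient _ _).obj (CochainComplex.mappingCone
      (S.map (CochainComplex.singleFunctor (FGModuleCat.{u} A) 0)).f)) :
    (gpAcyclicBounded A).trW (ObjectProperty.homMk (e.hom ≫ (HomotopyCategory.quotient _ _).map
      (CochainComplex.mappingCone.descShortComplex
        (S.map (CochainComplex.singleFunctor (FGModuleCat.{u} A) 0)))) :
          C ⟶ (singleBounded A).obj S.X₃) := by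
  obtain ⟨Z, a, b, hT⟩ := distinguished_cocone_triangle (ObjectProperty.homMk (e.hom ≫
    (HomotopyCategory.quotient _ _).map (CochainComplex.mappingCone.descShortComplex
      (S.map (CochainComplex.singleFunctor (FGModuleCat.{u} A) 0)))) :
        C ⟶ (singleBounded A).obj S.X₃)
  refine ObjectProperty.trW.mk _ hT ((gpAcyclic_iff _).2 fun P hP ↦ ?_)
  let F := (preadditiveCoyoneda.obj (Opposite.op P)).mapHomotopyCategory (.up ℤ)
  have hT' := F.map_distinguished _ ((HomotopyCategory.bounded _).ι.map_distinguished _ hT)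
  refine ((HomotopyCategory.subcategoryAcyclic AddCommGrpCat.{u}).trW_iff_of_distinguished _ hT').1 ?_
  rw [← HomotopyCategory.quasiIso_eq_trW_subcategoryAcyclic]
  change HomotopyCategory.quasiIso _ _ (F.map (e.hom ≫ (HomotopyCategory.quotient _ _).map _))
  rw [Functor.map_comp]
  refine (MorphismProperty.cancel_left_of_respectsIso
    (HomotopyCategory.quasiIso AddCommGrpCat.{u} (.up ℤ)) _ _).2 ?_
  exact (HomotopyCategory.quotient_map_mem_quasiIso_iff _).2
    (hS.quasiIso_map_descShortComplex hP)

variable {D : Type*} [Category* D] [HasZeroObject D] [Preadditive D] [HasShift D ℤ]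
  [∀ n : ℤ, (shiftFunctor D n).Additive] [Pretriangulated D]
  (L : HomotopyCategory.Bounded (FGModuleCat.{u} A) ⥤ D) [L.IsLocalization (gpAcyclicBounded A).trW]
  [L.CommShift ℤ] [L.IsTriangulated]

/-- A proper exact sequence becomes a distinguished triangle in the localization. -/
lemma IsProperExact.exists_distinguished {S : ShortComplex (FGModuleCat.{u} A)}
    (hS : IsProperExact S) :
    ∃ δ : (singleBounded A ⋙ L).obj S.X₃ ⟶ ((singleBounded A ⋙ L).obj S.X₁)⟦(1 : ℤ)⟧,
      Triangle.mk ((singleBounded A ⋙ L).map S.f) ((singleBounded A ⋙ L).map S.g) δ ∈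
        distTriang D := by
  obtain ⟨C, v, w, hT⟩ := distinguished_cocone_triangle ((singleBounded A).map S.f)
  let T' := (HomotopyCategory.bounded _).ι.mapTriangle.obj
    (Triangle.mk ((singleBounded A).map S.f) v w)
  let T'' := CochainComplex.mappingCone.triangleh
    (S.map (CochainComplex.singleFunctor (FGModuleCat.{u} A) 0)).f
  let e : T' ≅ T'' := isoTriangleOfIso₁₂ T' T''
    ((HomotopyCategory.bounded _).ι.map_distinguished _ hT)
    (HomotopyCategory.mappingCone_triangleh_distinguished _) (Iso.refl _) (Iso.refl _)
    ((Category.comp_id _).trans (Category.id_comp _).symm)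
  let e₃ : C.obj ≅ (HomotopyCategory.quotient _ _).obj (CochainComplex.mappingCone
      (S.map (CochainComplex.singleFunctor (FGModuleCat.{u} A) 0)).f) := Triangle.π₃.mapIso e
  let φ : C ⟶ (singleBounded A).obj S.X₃ := ObjectProperty.homMk
    (e₃.hom ≫ (HomotopyCategory.quotient _ _).map
      (CochainComplex.mappingCone.descShortComplex
        (S.map (CochainComplex.singleFunctor (FGModuleCat.{u} A) 0))))
  have hφ : v ≫ φ = (singleBounded A).map S.g := by
    apply ObjectProperty.hom_ext
    have h₁ : v.hom ≫ e₃.hom = (HomotopyCategory.quotient _ _).map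
        (CochainComplex.mappingCone.inr
          (S.map (CochainComplex.singleFunctor (FGModuleCat.{u} A) 0)).f) :=
      e.hom.comm₂.trans (Category.id_comp _)
    exact (Category.assoc _ _ _).symm.trans ((h₁ =≫ _).trans ((Functor.map_comp _ _ _).symm.trans
      (congrArg _ (CochainComplex.mappingCone.inr_descShortComplex _))))
  have hφ' : IsIso (L.map φ) :=
    Localization.inverts L (gpAcyclicBounded A).trW φ (hS.trW e₃)
  refine ⟨inv (L.map φ) ≫ L.map w ≫ (L.commShiftIso (1 : ℤ)).hom.app _,
    isomorphic_distinguished _ (L.map_distinguished _ hT) _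
      (Triangle.isoMk _ _ (Iso.refl _) (Iso.refl _) (asIso (L.map φ)).symm ?_ ?_ ?_)⟩
  · exact (Category.comp_id _).trans (Category.id_comp _).symm
  · change L.map ((singleBounded A).map S.g) ≫ inv (L.map φ) = 𝟙 _ ≫ L.map v
    rw [IsIso.comp_inv_eq, Category.id_comp, ← L.map_comp, hφ]
  · change (inv (L.map φ) ≫ L.map w ≫ (L.commShiftIso (1 : ℤ)).hom.app _) ≫ (𝟙 _)⟦1⟧' =
      inv (L.map φ) ≫ L.map w ≫ (L.commShiftIso (1 : ℤ)).hom.app _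
    exact (_ ≫= (shiftFunctor D (1 : ℤ)).map_id _).trans (Category.comp_id _)

end ProperSequences

/-! ### The generation level of a module -/

section Main

variable {A : Type u} [Ring A] [IsNoetherianRing A]

variable {D : Type*} [Category* D] [HasZeroObject D] [Preadditive D] [HasShift D ℤ]
  [∀ n : ℤ, (shiftFunctor D n).Additive] [Pretriangulated D]
  (L : HomotopyCategory.Bounded (FGModuleCat.{u} A) ⥤ D) [L.IsLocalization (gpAcyclicBounded A).trW]
  [L.CommShift ℤ] [L.IsTriangulated]

/-- In a proper exact sequence `0 ⟶ K ⟶ E ⟶ X ⟶ 0` whose first map has a retraction, `X` is a direct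
summand of `E`. -/
lemma IsProperExact.gorensteinProjective_of_retraction
    {S : ShortComplex (FGModuleCat.{u} A)} (hS : IsProperExact S)
    (hE : IsGorensteinProjective S.X₂) (r : S.X₂ ⟶ S.X₁) (hr : S.f ≫ r = 𝟙 _) :
    IsGorensteinProjective S.X₃ := by
  have hr' (x : S.X₁) : r.hom.hom (S.f.hom.hom x) = x := FGModuleCat.congr_hom hr x
  have hb : Function.Bijective (S.g.hom.hom.prod r.hom.hom) := by
    constructor
    · rw [injective_iff_map_eq_zero]
      intro x hx
      obtain ⟨y, rfl⟩ := (hS.exact x).1 (congrArg Prod.fst hx)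
      have : y = 0 := (hr' y).symm.trans (congrArg Prod.snd hx)
      rw [this, map_zero]
    · rintro ⟨x, y⟩
      obtain ⟨z, rfl⟩ := hS.surjective x
      refine ⟨z + S.f.hom.hom (y - r.hom.hom z), Prod.ext ?_ ?_⟩
      · change S.g.hom.hom (z + S.f.hom.hom (y - r.hom.hom z)) = S.g.hom.hom z
        rw [map_add, hS.exact.apply_apply_eq_zero, add_zero]
      · change r.hom.hom (z + S.f.hom.hom (y - r.hom.hom z)) = y
        rw [map_add, hr', add_sub_cancel]
  exact (hE.of_equiv (N := FGModuleCat.of A (S.X₃ × S.X₁)) (LinearEquiv.ofBijective _ hb)).of_prod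

omit [IsNoetherianRing A] in
/-- The connecting morphism of a proper exact sequence is a ghost. -/
lemma IsProperExact.annihilates {S : ShortComplex (FGModuleCat.{u} A)} (hS : IsProperExact S)
    {P : FGModuleCat.{u} A} (hP : IsGorensteinProjective P)
    (δ : (singleBounded A ⋙ L).obj S.X₃ ⟶ ((singleBounded A ⋙ L).obj S.X₁)⟦(1 : ℤ)⟧)
    (hδ : Triangle.mk ((singleBounded A ⋙ L).map S.f) ((singleBounded A ⋙ L).map S.g) δ ∈
        distTriang D) :
    Annihilates (generatedLevel ((singleBounded A ⋙ L).obj P) 1) δ := by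
  refine annihilates_generatedLevel_one fun j g ↦ ?_
  by_cases hj : j = 0
  · subst hj
    obtain ⟨f, hf⟩ := exists_map_eq L hP (g ≫ (shiftFunctorZero D ℤ).hom.app _)
    obtain ⟨h, rfl⟩ := hS.exists_lift P hP f
    refine comp_shift_zero_eq_zero g ?_
    rw [← hf, Functor.map_comp, Category.assoc]
    exact (_ ≫= comp_distTriang_mor_zero₂₃ _ hδ).trans comp_zero
  · rw [eq_zero_of_ne_zero L hP hj g, zero_comp]

lemma exists_isProperExact (k : Type*) [Field k] [Algebra k A] [FiniteDimensional k A] {m : ℕ}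
    {G : Fin m → FGModuleCat.{u} A} (hG : IsIndecGorensteinProjectiveList G)
    (X : FGModuleCat.{u} A) :
    ∃ S : ShortComplex (FGModuleCat.{u} A),
      S.X₃ = X ∧ IsProperExact S ∧ IsGorensteinProjective S.X₂ := by
  obtain ⟨E, p, hE, hp, hlift⟩ := exists_gorensteinProjective_approximation k hG X
  exact ⟨ShortComplex.mk
    (FGModuleCat.ofHom (LinearMap.ker p.hom.hom).subtype : FGModuleCat.of A _ ⟶ E) p (by
      ext x
      exact x.2), rfl,
    ⟨Subtype.val_injective, LinearMap.exact_subtype_ker_map _, hp, hlift⟩, hE⟩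

/-- Either `X` has a Gorenstein projective resolution of length `n`, or there is a nonzero map, out of
`X` in the localization, which annihilates `⟨P⟩_{n+1}`. This map is a composite of `n + 1` connecting
morphisms of proper exact sequences. -/
lemma resolution_or_exists_annihilates
    (hproper : ∀ X : FGModuleCat.{u} A, ∃ S : ShortComplex (FGModuleCat.{u} A),
      S.X₃ = X ∧ IsProperExact S ∧ IsGorensteinProjective S.X₂)
    {P : FGModuleCat.{u} A} (hP : IsGorensteinProjective P) (n : ℕ) (X : FGModuleCat.{u} A) :
    HasGorensteinProjectiveResolution X n ∨
      ∃ (Z : FGModuleCat.{u} A) (i : ℤ)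
        (f : (singleBounded A ⋙ L).obj X ⟶ ((singleBounded A ⋙ L).obj Z)⟦i⟧),
        0 < i ∧ f ≠ 0 ∧ Annihilates (generatedLevel ((singleBounded A ⋙ L).obj P) (n + 1)) f := by
  induction n generalizing X with
  | zero =>
    obtain ⟨S, rfl, hS, hE⟩ := hproper X
    obtain ⟨δ, hδ⟩ := hS.exists_distinguished L
    by_cases h₀ : δ = 0
    · left
      -- the first map of the triangle splits, and the splitting comes from a map of modules
      have hmono : Mono ((singleBounded A ⋙ L).map S.f) :=
        (Triangle.mor₃_eq_zero_iff_mono₁ _ hδ).1 h₀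
      obtain ⟨⟨r, hr⟩⟩ := isSplitMono_of_mono ((singleBounded A ⋙ L).map S.f)
      obtain ⟨r, rfl⟩ := exists_map_eq L hE r
      refine .zero (hS.gorensteinProjective_of_retraction hE r ?_)
      rw [← sub_eq_zero]
      apply eq_zero_of_map_eq_zero L
      rw [Functor.map_sub, Functor.map_comp, CategoryTheory.Functor.map_id, hr, sub_self]
    · exact Or.inr ⟨_, 1, δ, by lia, h₀, hS.annihilates L hP δ hδ⟩
  | succ n ih =>
    obtain ⟨S, rfl, hS, hE⟩ := hproper X
    obtain ⟨δ, hδ⟩ := hS.exists_distinguished L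
    obtain h | ⟨Z, i, f, hi, hf₀, hf⟩ := ih S.X₁
    · exact Or.inl (h.succ hE S.f S.g hS.injective hS.exact hS.surjective)
    · let e := (shiftFunctorAdd' D i 1 (i + 1) rfl).symm.app ((singleBounded A ⋙ L).obj Z)
      refine Or.inr ⟨Z, i + 1, (δ ≫ f⟦(1 : ℤ)⟧') ≫ e.hom, by lia, fun h ↦ hf₀ ?_,
        ((hS.annihilates L hP δ hδ).generatedLevel_comp (hf.shift 1)).comp e.hom⟩
      -- if the composite vanished, `f⟦1⟧` would factor through `S.X₂⟦1⟧ ⟶ Z⟦i⟧⟦1⟧`, which is zero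
      -- because `S.X₂` is Gorenstein projective and `i ≠ 0`
      obtain ⟨ψ, hψ⟩ := Triangle.yoneda_exact₃ _ (rot_of_distTriang _ hδ) (f⟦(1 : ℤ)⟧')
        ((cancel_mono e.hom).1 (h.trans zero_comp.symm))
      obtain ⟨ψ, rfl⟩ := (shiftFunctor D (1 : ℤ)).map_surjective ψ
      have hψ₀ : ψ = 0 := eq_zero_of_ne_zero L hE hi.ne' ψ
      rw [hψ₀, Functor.map_zero, comp_zero] at hψ
      exact (shiftFunctor D (1 : ℤ)).map_injective (hψ.trans (Functor.map_zero _ _ _).symm)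

end Main

theorem lemma4p1 {k : Type*} [Field k] {A : Type u} [Ring A] [Algebra k A]
    [FiniteDimensional k A] (hA : IsFiniteCMType A)
    {m : ℕ} (G : Fin m → FGModuleCat.{u} A) (hG : IsIndecGorensteinProjectiveList G)
    (X : FGModuleCat.{u} A) (hX : ¬ IsZero X) (n : ℕ) (hn : gorensteinProjectiveDim X = n) :
    ¬ generatedLevel (toGorensteinDerivedCategory (⨁ G)) n (toGorensteinDerivedCategory X) := by
  have : IsNoetherianRing A := isNoetherian_of_isNoetherianRing_of_finite k A |> fun h ↦
    isNoetherian_of_tower k h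
  let L := (gpAcyclicBounded A).trW.Q
  intro (h : generatedLevel ((singleBounded A ⋙ L).obj (⨁ G)) n ((singleBounded A ⋙ L).obj X))
  obtain _ | n := n
  · refine hX ((IsZero.iff_id_eq_zero X).2 (eq_zero_of_map_eq_zero L _ ?_))
    rw [generatedLevel] at h
    exact h.eq_of_src _ _
  · obtain hr | ⟨Z, i, f, hi, hf₀, hf⟩ := resolution_or_exists_annihilates L
      (exists_isProperExact k hG) (IsGorensteinProjective.biproduct G hG.gorensteinProjective) n X
    · have : gorensteinProjectiveDim X ≤ n := sInf_le ⟨n, rfl, hr⟩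
      rw [hn, Nat.cast_le] at this
      lia
    · exact hf₀ (hf.eq_zero h)
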